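/- For $n\ge 0$ let $S_n$ be the set of permutations of $\{1,\dots,n\}$ and, for a pattern $\tau$, let $S_n(\tau)$ be the set of $\sigma\in S_n$ that avoid $\tau$ (no subsequence of $\sigma(1)\cdots\sigma(n)$ is order isomorphic to $\tau$). A crossing of $\sigma\in S_n$ is a pair $(i,j)$ with $i<j<\sigma(i)<\sigma(j)$ or $\sigma(i)<\sigma(j)\le i<j$; let $\operatorname{crs}(\sigma)$ be the number of crossings of $\sigma$. The Elizalde–Pak map $\Theta=\Phi^{-1}\circ\Psi$ on $S_n(321)$ is defined as follows. For $\sigma\in S_n(321)$ let $(P,Q)$ be the pair of tableaux (with at most two rows) that the Robinson–Schensted correspondence (row insertion) assigns to $\sigma$, where $P$ is the insertion tableau and $Q$ the recording tableau. Then $\Psi(\sigma)$ is the Dyck path of length $2n$ whose $i$-th step, for $i=1,\dots,n$, is an up step if $i$ lies in the first row of $P$ and a down step if $i$ lies in the second row of $P$, and whose last $n$ steps are, for $j=n,n-1,\dots,1$ in this order, an up step if $j$ lies in the second row of $Q$ and a down step if $j$ lies in the first row of $Q$. For a Dyck path $D$ of length $2n$, number its up steps from left to right by $n,n-1,\dots,1$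 and its down steps from left to right by $1,2,\dots,n$. A tunnel of $D$ is a horizontal segment joining two distinct points of $D$ that meets $D$ only in these two points and lies below $D$. Then $\Phi^{-1}(D)$ is the permutation of $\{1,\dots,n\}$ that sends $p$ to $q$ if and only if the starting point of the up step numbered $p$ and the end point of the down step numbered $q$ are the two end points of a tunnel of $D$. **Theorem.** For every $n$, the map $\Theta$ is a bijection from $S_n(321)$ onto $S_n(132)$, and $$\operatorname{crs}(\Theta(\sigma))=\operatorname{crs}(\sigma)\qquad\text{for every }\sigma\in S_n(321).$$ -/

import Mathlib

/-!
Crossings of permutations, pattern avoidance, and the Elizalde–Pak map from 321-avoiding to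
132-avoiding permutations: the Robinson–Schensted correspondence (two tableaux with at most two
rows), the associated Dyck path, and the reading of a permutation off the tunnels of the path.

Permutations of `{1, …, n}` are elements of `Equiv.Perm (Fin n)`: positions and values are
shifted down by one, which changes none of the order relations below.
-/

namespace ElizaldePak

/-! ### Patterns and crossings -/

/-- `σ` contains the pattern `τ`: some subsequence of `σ` is order isomorphic to `τ`. -/
def ContainsPattern {m n : ℕ} (σ : Equiv.Perm (Fin n)) (τ : Equiv.Perm (Fin m)) : Prop :=
  ∃ f : Fin m → Fin n, StrictMono f ∧ ∀ i j, σ (f i) < σ (f j) ↔ τ i < τ j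

/-- The set `S_n(τ)` of the permutations of length `n` that avoid `τ`. -/
def Avoiders {m : ℕ} (n : ℕ) (τ : Equiv.Perm (Fin m)) : Set (Equiv.Perm (Fin n)) :=
  {σ | ¬ ContainsPattern σ τ}

/-- The permutation `3 2 1`. -/
def p321 : Equiv.Perm (Fin 3) := Equiv.swap 0 2

/-- The permutation `1 3 2`. -/
def p132 : Equiv.Perm (Fin 3) := Equiv.swap 1 2

/-- The number of crossings: pairs `(i, j)` with `i < j < σ i < σ j` or `σ i < σ j ≤ i < j`. -/
def crs {n : ℕ} (σ : Equiv.Perm (Fin n)) : ℕ :=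
  (Finset.univ.filter fun p : Fin n × Fin n =>
    (p.1 < p.2 ∧ p.2 < σ p.1 ∧ σ p.1 < σ p.2) ∨
    (σ p.1 < σ p.2 ∧ σ p.2 ≤ p.1 ∧ p.1 < p.2)).card

/-! ### The Robinson–Schensted correspondence -/

/-- The one-line notation `σ(1) σ(2) … σ(n)` of `σ` (with values in `{0, …, n - 1}`). -/
def word {n : ℕ} (σ : Equiv.Perm (Fin n)) : List ℕ := List.ofFn fun i => (σ i : ℕ)

/-- Insertion of `x` in a row: `x` replaces the leftmost entry greater than `x`, which is
bumped out, or it is put at the end of the row if there is no such entry. -/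
def rowInsert (x : ℕ) : List ℕ → List ℕ × Option ℕ
  | [] => ([x], none)
  | y :: r => if x < y then (x :: r, some y) else (y :: (rowInsert x r).1, (rowInsert x r).2)

/-- Insertion of `x` in a tableau, given as the list of its rows: the entry bumped out of a row
is inserted in the next one. The second component is the index of the row that has grown. -/
def tabInsert : ℕ → List (List ℕ) → List (List ℕ) × ℕ
  | x, [] => ([[x]], 0)
  | x, r :: T =>
    match (rowInsert x r).2 with
    | none => ((rowInsert x r).1 :: T, 0)
    | some y => ((rowInsert x r).1 :: (tabInsert y T).1, (tabInsert y T).2 + 1)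

/-- Put `i` in a new cell at the end of the `k`-th row (a new row if the tableau has only `k`
rows). -/
def addCell (i : ℕ) : ℕ → List (List ℕ) → List (List ℕ)
  | _, [] => [[i]]
  | 0, r :: T => (r ++ [i]) :: T
  | k + 1, r :: T => r :: addCell i k T

/-- One step of the correspondence: `p = (x, i)` is a letter of the word with its position. -/
def rskStep (PQ : List (List ℕ) × List (List ℕ)) (p : ℕ × ℕ) :
    List (List ℕ) × List (List ℕ) :=
  ((tabInsert p.1 PQ.1).1, addCell p.2 (tabInsert p.1 PQ.1).2 PQ.2)

/-- The pair `(P, Q)` of the insertion tableau and the recording tableau of a word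
(positions in the word count from `0`). -/
def rsk (w : List ℕ) : List (List ℕ) × List (List ℕ) := w.zipIdx.foldl rskStep ([], [])

/-- The `k`-th row of a tableau (`k = 0` is the first row), empty if there is none. -/
def row (k : ℕ) (T : List (List ℕ)) : List ℕ := T.getD k []

/-! ### From permutations to paths -/

/-- The path of `σ`. Its left half has, for `i` from `1` to `n`, an up step if `i` is in the first
row of `P` and a down step if it is in the second row; its right half has, for `j` from `n` to `1`,
an up step if `j` is in the second row of `Q` and a down step if it is in the first row. -/
def path {n : ℕ} (σ : Equiv.Perm (Fin n)) : List DyckStep :=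
  ((List.range n).map fun i =>
    if i ∈ row 0 (rsk (word σ)).1 then DyckStep.U else DyckStep.D) ++
  ((List.range n).reverse.map fun j =>
    if j ∈ row 0 (rsk (word σ)).2 then DyckStep.D else DyckStep.U)

/-! #### The path of a 321-avoiding permutation is a Dyck path -/

theorem row_zero_tabInsert (x : ℕ) (T : List (List ℕ)) :
    row 0 (tabInsert x T).1 = (rowInsert x (row 0 T)).1 := by
  cases T with
  | nil => rfl
  | cons r T =>
    simp only [tabInsert, row, List.getD_cons_zero]
    cases (rowInsert x r).2 <;> rfl

theorem row_one_tabInsert_none {x : ℕ} {T : List (List ℕ)}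
    (h : (rowInsert x (row 0 T)).2 = none) :
    row 1 (tabInsert x T).1 = row 1 T ∧ (tabInsert x T).2 = 0 := by
  cases T with
  | nil => exact ⟨rfl, rfl⟩
  | cons r T =>
    simp only [row, List.getD_cons_zero] at h
    simp [tabInsert, row, h]

theorem row_one_tabInsert_some {x y : ℕ} {T : List (List ℕ)}
    (h : (rowInsert x (row 0 T)).2 = some y)
    (hy : (rowInsert y (row 1 T)).2 = none) :
    row 1 (tabInsert x T).1 = (rowInsert y (row 1 T)).1 ∧ (tabInsert x T).2 = 1 := by
  cases T with
  | nil => simp [row, rowInsert] at h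
  | cons r T =>
    simp only [row, List.getD_cons_zero] at h
    have h0 := row_zero_tabInsert y T
    have h1 : row 1 (r :: T) = row 0 T := by simp [row]
    rw [h1] at hy ⊢
    rw [← h0]
    refine ⟨by simp [tabInsert, row, h], ?_⟩
    simp only [tabInsert, h, Nat.add_eq_right]
    cases T with
    | nil => rfl
    | cons s T => exact (row_one_tabInsert_none hy).2

theorem row_addCell_zero (i : ℕ) (T : List (List ℕ)) :
    row 0 (addCell i 0 T) = row 0 T ++ [i] ∧ row 1 (addCell i 0 T) = row 1 T := by
  cases T <;> simp [addCell, row]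

theorem row_addCell_one (i : ℕ) {T : List (List ℕ)} (hT : row 0 T ≠ []) :
    row 0 (addCell i 1 T) = row 0 T ∧ row 1 (addCell i 1 T) = row 1 T ++ [i] := by
  cases T with
  | nil => simp [row] at hT
  | cons r T =>
    have := (row_addCell_zero i T).1
    simp only [row, List.getD_eq_getElem?_getD] at this
    simpa [addCell, row] using this

theorem rowInsert_none {x : ℕ} {r : List ℕ} :
    (rowInsert x r).2 = none → (rowInsert x r).1 = r ++ [x] ∧ ∀ z ∈ r, z ≤ x := by
  induction r with
  | nil => simp [rowInsert]
  | cons y r ih =>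
    by_cases h : x < y
    · simp [rowInsert, h]
    · simp only [rowInsert, h, if_false]
      intro h'
      obtain ⟨h1, h2⟩ := ih h'
      exact ⟨by simp [h1], by simpa using ⟨by omega, h2⟩⟩

theorem rowInsert_eq_none {x : ℕ} {r : List ℕ} (h : ∀ z ∈ r, z ≤ x) :
    (rowInsert x r).2 = none := by
  induction r with
  | nil => rfl
  | cons y r ih =>
    have hy := h y (by simp)
    simp only [rowInsert, not_lt.2 hy, if_false]
    exact ih fun z hz => h z (by simp [hz])

theorem rowInsert_some {x y : ℕ} {r : List ℕ} :
    (rowInsert x r).2 = some y → ∃ s t, r = s ++ y :: t ∧ (rowInsert x r).1 = s ++ x :: t ∧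
      x < y ∧ ∀ z ∈ s, z ≤ x := by
  induction r with
  | nil => simp [rowInsert]
  | cons a r ih =>
    by_cases h : x < a
    · simp only [rowInsert, h, if_true, Option.some.injEq]
      rintro rfl
      exact ⟨[], r, rfl, rfl, h, by simp⟩
    · simp only [rowInsert, h, if_false]
      intro h'
      obtain ⟨s, t, h1, h2, h3, h4⟩ := ih h'
      exact ⟨a :: s, t, by simp [h1], by simp [h2], h3, by simpa using ⟨by omega, h4⟩⟩

/-- The number of entries of `r` that are less than `v`. -/
def cnt (v : ℕ) (r : List ℕ) : ℕ := r.countP (· < v)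

/-- What is known of `(P, Q)` after the insertion of a 321-avoiding word `w`. -/
structure Inv (w : List ℕ) (P Q : List (List ℕ)) : Prop where
  permP : (row 0 P ++ row 1 P).Perm w
  sorted : (row 0 P).Pairwise (· < ·)
  ballotP : ∀ v, cnt v (row 1 P) ≤ cnt v (row 0 P)
  bumped : ∀ z ∈ row 1 P, ∀ y ∈ row 0 P, y < z → ∃ u, List.Sublist [z, u] w ∧ y ≤ u ∧ u < z
  permQ : (row 0 Q ++ row 1 Q).Perm (List.range w.length)
  ballotQ : ∀ v, cnt v (row 1 Q) ≤ cnt v (row 0 Q)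
  len0 : (row 0 P).length = (row 0 Q).length
  len1 : (row 1 P).length = (row 1 Q).length

theorem cnt_le (v : ℕ) (r : List ℕ) : cnt v r ≤ r.length := List.countP_le_length

theorem cnt_of_forall {v : ℕ} {r : List ℕ} (h : ∀ z ∈ r, z < v) : cnt v r = r.length := by
  rw [cnt, List.countP_eq_length]; simpa using h

theorem cnt_append (v : ℕ) (r s : List ℕ) : cnt v (r ++ s) = cnt v r + cnt v s :=
  List.countP_append

theorem cnt_cons (v x : ℕ) (r : List ℕ) : cnt v (x :: r) = cnt v r + if x < v then 1 else 0 := by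
  simp [cnt, List.countP_cons]

theorem cnt_mono {u v : ℕ} (h : u ≤ v) (r : List ℕ) : cnt u r ≤ cnt v r := by
  apply List.countP_mono_left
  intro x _ hx
  simp only [decide_eq_true_eq] at hx ⊢
  omega

theorem ballot_append {m : ℕ} {a b a' b' : List ℕ} (hp : (a ++ b).Perm (List.range m))
    (hb : ∀ v, cnt v b ≤ cnt v a) (hl : b'.length ≤ a'.length)
    (h : (a' = a ++ [m] ∧ b' = b) ∨ (a' = a ∧ b' = b ++ [m])) (v : ℕ) :
    cnt v b' ≤ cnt v a' := by
  have hlt : ∀ z ∈ a ++ b, z < m := fun z hz => List.mem_range.1 (hp.mem_iff.1 hz)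
  rcases h with ⟨rfl, rfl⟩ | ⟨rfl, rfl⟩
  · rw [cnt_append]; exact (hb v).trans (Nat.le_add_right _ _)
  · by_cases hv : m < v
    · rw [cnt_of_forall, cnt_of_forall]
      · exact hl
      · intro z hz; have := hlt z (by simp [hz]); omega
      · intro z hz
        rcases List.mem_append.1 hz with hz | hz
        · have := hlt z (by simp [hz]); omega
        · simp at hz; omega
    · have := hb v
      rw [cnt_append, cnt_cons]
      simpa [hv, cnt] using this

theorem Inv.step {w : List ℕ} {P Q : List (List ℕ)} (h : Inv w P Q) (x : ℕ)
    (hnd : (w ++ [x]).Nodup)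
    (hav : ∀ a b c, List.Sublist [c, b, a] (w ++ [x]) → a < b → ¬ b < c) :
    Inv (w ++ [x]) (rskStep (P, Q) (x, w.length)).1 (rskStep (P, Q) (x, w.length)).2 := by
  have hx : ∀ z ∈ row 0 P ++ row 1 P, z ≠ x := by
    intro z hz hzx
    have hzw := h.permP.mem_iff.1 hz
    have := List.nodup_append.1 hnd
    exact this.2.2 z hzw x (by simp) hzx
  have hlen : (w ++ [x]).length = w.length + 1 := by simp
  have hsub : ∀ {z u : ℕ}, List.Sublist [z, u] w → List.Sublist [z, u] (w ++ [x]) :=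
    fun hs => hs.trans (List.sublist_append_left _ _)
  have hsub' : ∀ {z : ℕ}, z ∈ row 0 P ++ row 1 P → List.Sublist [z, x] (w ++ [x]) := fun hz =>
    List.Sublist.append (List.singleton_sublist.2 (h.permP.mem_iff.1 hz)) (List.Sublist.refl [x])
  simp only [rskStep]
  have r0 := row_zero_tabInsert x P
  cases hb : (rowInsert x (row 0 P)).2 with
  | none =>
    obtain ⟨r1, k⟩ := row_one_tabInsert_none hb
    obtain ⟨e, hle⟩ := rowInsert_none hb
    rw [e] at r0
    obtain ⟨q0, q1⟩ := row_addCell_zero w.length Q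
    rw [k]
    have hball : ∀ v, cnt v (row 1 P) ≤ cnt v (row 0 P ++ [x]) := fun v => by
      rw [cnt_append]; exact (h.ballotP v).trans (Nat.le_add_right _ _)
    have l0 : (row 0 (tabInsert x P).1).length = (row 0 (addCell w.length 0 Q)).length := by
      rw [r0, q0]; simp [h.len0]
    have l1 : (row 1 (tabInsert x P).1).length = (row 1 (addCell w.length 0 Q)).length := by
      rw [r1, q1]; exact h.len1
    refine ⟨?_, ?_, ?_, ?_, ?_, ?_, l0, l1⟩
    · rw [r0, r1, List.append_assoc]
      refine (List.Perm.append_left _ List.perm_append_comm).trans ?_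
      rw [← List.append_assoc]
      exact h.permP.append_right _
    · rw [r0, List.pairwise_append]
      refine ⟨h.sorted, by simp, ?_⟩
      intro z hz y hy
      have hz1 := hle z hz
      have hz2 := hx z (by simp [hz])
      simp at hy; omega
    · rw [r0, r1]; exact hball
    · rw [r0, r1]
      intro z hz y hy hyz
      rcases List.mem_append.1 hy with hy | hy
      · obtain ⟨u, hu1, hu2⟩ := h.bumped z hz y hy hyz
        exact ⟨u, hsub hu1, hu2⟩
      · simp at hy; subst hy
        exact ⟨y, hsub' (by simp [hz]), le_refl _, hyz⟩
    · rw [q0, q1, hlen, List.range_succ, List.append_assoc]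
      refine (List.Perm.append_left _ List.perm_append_comm).trans ?_
      rw [← List.append_assoc]
      exact h.permQ.append_right _
    · refine ballot_append h.permQ h.ballotQ ?_ (Or.inl ⟨q0, q1⟩)
      rw [q0, q1, List.length_append]
      have := h.len0; have := h.len1
      have := h.ballotP (w.sum + 1)
      have hs : ∀ z ∈ row 0 P ++ row 1 P, z < w.sum + 1 := fun z hz =>
        Nat.lt_succ_of_le (List.single_le_sum (by simp) z (h.permP.mem_iff.1 hz))
      rw [cnt_of_forall (fun z hz => hs z (by simp [hz])),
        cnt_of_forall (fun z hz => hs z (by simp [hz]))] at this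
      omega
  | some y =>
    obtain ⟨s, t, e, e', hxy, hs⟩ := rowInsert_some hb
    have hy0 : y ∈ row 0 P := by rw [e]; simp
    have hmax : ∀ z ∈ row 1 P, z ≤ y := by
      intro z hz
      by_contra hc
      obtain ⟨u, hu1, hu2, hu3⟩ := h.bumped z hz y hy0 (by omega)
      exact hav x u z (hu1.append (List.Sublist.refl [x])) (by omega) hu3
    have hny : (rowInsert y (row 1 P)).2 = none := rowInsert_eq_none hmax
    obtain ⟨r1, k⟩ := row_one_tabInsert_some hb hny
    rw [(rowInsert_none hny).1] at r1
    rw [e'] at r0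
    have hQ : row 0 Q ≠ [] := by
      intro hq
      have := h.len0
      rw [e, hq] at this
      simp at this
    obtain ⟨q0, q1⟩ := row_addCell_one w.length hQ
    rw [k]
    have hso := h.sorted
    rw [e, List.pairwise_append, List.pairwise_cons] at hso
    obtain ⟨so1, ⟨so2, so3⟩, so4⟩ := hso
    have hyne : ∀ z ∈ row 1 P, z < y := by
      intro z hz
      refine lt_of_le_of_ne (hmax z hz) ?_
      rintro rfl
      have := (h.permP.nodup_iff).2 (List.nodup_append.1 hnd).1
      exact (List.nodup_append.1 this).2.2 z hy0 z hz rfl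
    have hball : ∀ v, cnt v (row 1 P ++ [y]) ≤ cnt v (s ++ x :: t) := by
      intro v
      have h1 := h.ballotP v
      have h2 := h.ballotP y
      rw [e, cnt_append, cnt_cons] at h1 h2
      rw [cnt_append, cnt_append, cnt_cons, cnt_cons]
      have c0 : cnt v ([] : List ℕ) = 0 := rfl
      rw [c0]
      by_cases hv : y < v
      · rw [cnt_of_forall hyne] at h2
        have ht : cnt y t = 0 := by
          rw [cnt, List.countP_eq_zero]
          intro z hz
          have := so2 z hz
          simp; omega
        have := cnt_le v (row 1 P)
        have := cnt_mono hv.le s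
        simp only [lt_irrefl, if_false] at h2
        simp only [hv, hxy.trans hv, if_true]
        omega
      · simp only [hv, if_false] at h1 ⊢
        omega
    have l0 : (row 0 (tabInsert x P).1).length = (row 0 (addCell w.length 1 Q)).length := by
      rw [r0, q0, ← h.len0, e]; simp
    have l1 : (row 1 (tabInsert x P).1).length = (row 1 (addCell w.length 1 Q)).length := by
      rw [r1, q1]; simp [h.len1]
    have hpm : ((s ++ x :: t) ++ (row 1 P ++ [y])).Perm (w ++ [x]) := by
      have := h.permP
      rw [e] at this
      refine List.Perm.trans ?_ (this.append_right [x])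
      rw [List.perm_iff_count]
      intro a
      simp only [List.count_append, List.count_cons, List.count_nil]
      omega
    refine ⟨?_, ?_, ?_, ?_, ?_, ?_, l0, l1⟩
    · rw [r0, r1]; exact hpm
    · rw [r0, List.pairwise_append, List.pairwise_cons]
      refine ⟨so1, ⟨fun z hz => hxy.trans (so2 z hz), so3⟩, ?_⟩
      intro a ha b hb'
      have hax : a < x := lt_of_le_of_ne (hs a ha) (hx a (by rw [e]; simp [ha]))
      rcases List.mem_cons.1 hb' with rfl | hb'
      · exact hax
      · have := so2 b hb'; omega
    · rw [r0, r1]; exact hball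
    · rw [r0, r1]
      intro z hz a ha haz
      have hzmem : z ∈ row 0 P ++ row 1 P := by
        rcases List.mem_append.1 hz with hz | hz
        · simp [hz]
        · simp at hz; subst hz; simp [hy0]
      by_cases hax : a = x
      · exact ⟨x, hsub' hzmem, hax.le, by omega⟩
      have ha0 : a ∈ s ∨ a ∈ t := by
        simpa [hax] using ha
      rcases List.mem_append.1 hz with hz | hz
      · obtain ⟨u, hu1, hu2⟩ := h.bumped z hz a
          (by rw [e]; rcases ha0 with h | h <;> simp [h]) haz
        exact ⟨u, hsub hu1, hu2⟩
      · simp at hz; subst hz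
        rcases ha0 with h | h
        · exact ⟨x, hsub' hzmem, hs a h, hxy⟩
        · have := so2 a h; omega
    · rw [q0, q1, hlen, List.range_succ, ← List.append_assoc]
      exact h.permQ.append_right _
    · refine ballot_append h.permQ h.ballotQ ?_ (Or.inr ⟨q0, q1⟩)
      rw [← l0, ← l1, r0, r1]
      have := hball (w.sum + x + 1)
      have hs : ∀ z ∈ (s ++ x :: t) ++ (row 1 P ++ [y]), z < w.sum + x + 1 := fun z hz => by
        have := List.single_le_sum (by simp) z (hpm.mem_iff.1 hz)
        simp at this; omega
      rw [cnt_of_forall (fun z hz => hs z (List.mem_append_right _ hz)),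
        cnt_of_forall (fun z hz => hs z (List.mem_append_left _ hz))] at this
      exact this

theorem inv_rsk (w : List ℕ) (hnd : w.Nodup)
    (hav : ∀ a b c, List.Sublist [c, b, a] w → a < b → ¬ b < c) :
    Inv w (rsk w).1 (rsk w).2 := by
  induction w using List.reverseRecOn with
  | nil =>
    constructor <;> simp [rsk, row, cnt]
  | append_singleton w x ih =>
    have := (ih (List.nodup_append.1 hnd).1 fun a b c hs =>
      hav a b c (hs.trans (List.sublist_append_left _ _))).step x hnd hav
    simpa [rsk, List.zipIdx_append] using this

theorem inv_word {n : ℕ} {σ : Equiv.Perm (Fin n)} (hσ : σ ∈ Avoiders n p321) :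
    Inv (word σ) (rsk (word σ)).1 (rsk (word σ)).2 := by
  apply inv_rsk
  · rw [word, List.nodup_ofFn]
    exact Fin.val_injective.comp σ.injective
  · intro a b c hs hab hbc
    rw [List.sublist_iff_exists_fin_orderEmbedding_get_eq] at hs
    obtain ⟨f, hf⟩ := hs
    have hl : (word σ).length = n := by simp [word]
    apply hσ
    refine ⟨fun i => Fin.cast hl (f i), fun i j hij => by simpa using f.strictMono hij, ?_⟩
    have key : ∀ i, (σ (Fin.cast hl (f i)) : ℕ) = [c, b, a].get i := by
      intro i; rw [hf i]; simp [word]; rfl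
    intro i j
    rw [Fin.lt_def, key, key]
    fin_cases i <;> fin_cases j <;> simp [p321, Equiv.swap_apply_def] <;> omega

theorem countP_range_mem {a : List ℕ} (ha : a.Nodup) (v : ℕ) :
    (List.range v).countP (· ∈ a) = cnt v a := by
  rw [cnt, List.countP_eq_length_filter, List.countP_eq_length_filter]
  apply List.Perm.length_eq
  rw [List.perm_ext_iff_of_nodup (List.nodup_range.filter _) (ha.filter _)]
  intro x
  simp [and_comm]

theorem count_range_map {n v : ℕ} {a b : List ℕ} (h : (a ++ b).Perm (List.range n)) (hv : v ≤ n)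
    {s t : DyckStep} (hst : s ≠ t) :
    ((List.range v).map fun i => if i ∈ a then s else t).count s = cnt v a ∧
    ((List.range v).map fun i => if i ∈ a then s else t).count t = cnt v b := by
  have hnd := List.nodup_append.1 (h.nodup_iff.2 List.nodup_range)
  rw [← countP_range_mem hnd.1, ← countP_range_mem hnd.2.1, List.count, List.count,
    List.countP_map, List.countP_map]
  constructor <;> apply List.countP_congr
  · intro i _
    by_cases hi : i ∈ a <;> simp [hi, hst.symm]
  · intro i hi
    have hi' : i ∈ a ++ b := h.mem_iff.2 (List.mem_range.2 (by have := List.mem_range.1 hi; omega))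
    by_cases ha : i ∈ a
    · have : i ∉ b := fun hb => hnd.2.2 i ha i hb rfl
      simp [ha, this, hst]
    · have : i ∈ b := by simpa [ha] using hi'
      simp [ha, this]

theorem cnt_full {n : ℕ} {a b : List ℕ} (h : (a ++ b).Perm (List.range n)) :
    cnt n a = a.length ∧ cnt n b = b.length :=
  ⟨cnt_of_forall fun z hz => List.mem_range.1 (h.mem_iff.1 (by simp [hz])),
    cnt_of_forall fun z hz => List.mem_range.1 (h.mem_iff.1 (by simp [hz]))⟩

theorem perm_word {n : ℕ} (σ : Equiv.Perm (Fin n)) : (word σ).Perm (List.range n) := by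
  have hnd : (word σ).Nodup := by
    rw [word, List.nodup_ofFn]
    exact Fin.val_injective.comp σ.injective
  rw [List.perm_ext_iff_of_nodup hnd List.nodup_range]
  intro x
  rw [word, List.mem_ofFn, List.mem_range]
  exact ⟨by rintro ⟨i, rfl⟩; exact (σ i).2, fun hx => ⟨σ.symm ⟨x, hx⟩, by simp⟩⟩

theorem count_path_take {n : ℕ} {σ : Equiv.Perm (Fin n)} (hσ : σ ∈ Avoiders n p321) (k : ℕ) :
    ((path σ).take k).count DyckStep.D ≤ ((path σ).take k).count DyckStep.U ∧
    (2 * n ≤ k → ((path σ).take k).count DyckStep.U = ((path σ).take k).count DyckStep.D) := by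
  have I := inv_word hσ
  have hP := I.permP.trans (perm_word σ)
  have hQ := I.permQ
  rw [show (word σ).length = n by simp [word]] at hQ
  have hne : DyckStep.U ≠ DyckStep.D := by decide
  have L := fun (v : ℕ) (hv : v ≤ n) => count_range_map hP hv hne
  have R := fun (v : ℕ) (hv : v ≤ n) => count_range_map hQ hv hne.symm
  rw [path, List.take_append, ← List.map_take, ← List.map_take, List.take_range,
    List.take_reverse, List.count_append, List.count_append, List.map_reverse,
    List.count_reverse, List.count_reverse]
  simp only [List.length_map, List.length_range]
  rw [(L _ (min_le_right k n)).1, (L _ (min_le_right k n)).2]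
  set d := n - (k - n) with hd
  have hsplit : ∀ s, ((List.range n).map fun j =>
        if j ∈ row 0 (rsk (word σ)).2 then DyckStep.D else DyckStep.U).count s =
      ((List.range d).map fun j =>
        if j ∈ row 0 (rsk (word σ)).2 then DyckStep.D else DyckStep.U).count s +
      (((List.range n).drop d).map fun j =>
        if j ∈ row 0 (rsk (word σ)).2 then DyckStep.D else DyckStep.U).count s := by
    intro s
    rw [← List.count_append, ← List.map_append]
    congr 2
    conv_lhs => rw [← List.take_append_drop d (List.range n), List.take_range]
    rw [min_eq_left (by omega)]
  have hU := hsplit DyckStep.U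
  have hD := hsplit DyckStep.D
  rw [(R n le_rfl).1, (R d (by omega)).1] at hD
  rw [(R n le_rfl).2, (R d (by omega)).2] at hU
  have b1 := I.ballotP (min k n)
  have b2 := I.ballotQ d
  have l0 := I.len0
  have l1 := I.len1
  obtain ⟨p0, p1⟩ := cnt_full hP
  obtain ⟨q0, q1⟩ := cnt_full hQ
  rcases le_total k n with hk | hk
  · have hdn : d = n := by omega
    rw [hdn] at hU hD ⊢
    refine ⟨by omega, fun h => ?_⟩
    have : n = 0 := by omega
    subst this
    have hk0 : k = 0 := by omega
    subst hk0
    simp [cnt]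
  · rw [min_eq_right hk] at b1 ⊢
    refine ⟨by omega, fun h => ?_⟩
    have hd0 : d = 0 := by omega
    rw [hd0] at hU hD
    simp [cnt] at hU hD
    simp only [hd0, List.drop_zero]
    simp only [cnt] at *
    omega

/-- The map `Ψ` from 321-avoiding permutations to Dyck paths. -/
def psi {n : ℕ} (σ : Avoiders n p321) : DyckWord where
  toList := path σ.1
  count_U_eq_count_D := by
    have := (count_path_take σ.2 (2 * n)).2 le_rfl
    rwa [List.take_of_length_le (by simp [path]; omega)] at this
  count_D_le_count_U k := (count_path_take σ.2 k).1

theorem semilength_psi {n : ℕ} (σ : Avoiders n p321) : (psi σ).semilength = n := by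
  have h1 := (psi σ).two_mul_semilength_eq_length
  have h2 : (psi σ).toList.length = n + n := by simp [psi, path]
  omega

/-! ### From Dyck paths to permutations -/

/-- The height of the path `D` above the axis after `k` steps. -/
def height (D : DyckWord) (k : ℕ) : ℤ :=
  ((D.toList.take k).count DyckStep.U : ℤ) - (D.toList.take k).count DyckStep.D

/-- The horizontal segment between the vertices of `D` with abscissas `a < b` is a tunnel: it meets
`D` only in its end points and lies below `D`. -/
def IsTunnel (D : DyckWord) (a b : ℕ) : Prop :=
  a < b ∧ height D a = height D b ∧ ∀ k, a < k → k < b → height D a < height D k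

/-- Number the up steps of `D` from left to right by `n, …, 1` and its down steps by `1, …, n`,
where `n` is the semilength. `Linked D p q` says that the origin of the up step numbered `p + 1` and
the end of the down step numbered `q + 1` are the end points of a tunnel. (The up step with origin
at abscissa `a` has as many up steps on its right as its number minus one.) -/
def Linked (D : DyckWord) (p q : ℕ) : Prop :=
  ∃ a b, D.toList[a]? = some DyckStep.U ∧ (D.toList.drop (a + 1)).count DyckStep.U = p ∧
    D.toList[b]? = some DyckStep.D ∧ (D.toList.take b).count DyckStep.D = q ∧
    IsTunnel D a (b + 1)

theorem height_succ_U {D : DyckWord} {a : ℕ} (h : D.toList[a]? = some DyckStep.U) :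
    height D (a + 1) = height D a + 1 := by
  simp [height, List.take_add_one, h]; ring

theorem height_succ_D {D : DyckWord} {a : ℕ} (h : D.toList[a]? = some DyckStep.D) :
    height D (a + 1) = height D a - 1 := by
  simp [height, List.take_add_one, h]; ring

theorem exists_occ {s : DyckStep} {l : List DyckStep} {c : ℕ} (h : c < l.count s) :
    ∃ a, l[a]? = some s ∧ (l.take a).count s = c := by
  induction l generalizing c with
  | nil => simp at h
  | cons x l ih =>
    by_cases hx : x = s
    · subst hx
      cases c with
      | zero => exact ⟨0, by simp⟩
      | succ c =>
        obtain ⟨a, h1, h2⟩ := ih (c := c) (by simpa using h)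
        exact ⟨a + 1, by simpa using h1, by simpa using h2⟩
    · obtain ⟨a, h1, h2⟩ := ih (c := c) (by simpa [List.count_cons, hx] using h)
      exact ⟨a + 1, by simpa using h1, by simpa [List.count_cons, hx] using h2⟩

theorem occ_unique {s : DyckStep} {l : List DyckStep} {a b : ℕ} (ha : l[a]? = some s)
    (hb : l[b]? = some s) (h : (l.take a).count s = (l.take b).count s) : a = b := by
  have key : ∀ {a b : ℕ}, l[a]? = some s → a < b →
      (l.take a).count s < (l.take b).count s := by
    intro a b ha hab
    have h1 : (l.take (a + 1)).count s = (l.take a).count s + 1 := by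
      simp [List.take_add_one, ha]
    have h2 : (l.take (a + 1)).count s ≤ (l.take b).count s :=
      (List.take_sublist_take_left hab).count_le s
    omega
  rcases lt_trichotomy a b with hab | hab | hab
  · have := key ha hab; omega
  · exact hab
  · have := key hb hab; omega

theorem count_drop_U {D : DyckWord} {a : ℕ} (h : D.toList[a]? = some DyckStep.U) :
    (D.toList.drop (a + 1)).count DyckStep.U + (D.toList.take a).count DyckStep.U + 1 =
      D.semilength := by
  have h1 : (D.toList.take (a + 1)).count DyckStep.U =
      (D.toList.take a).count DyckStep.U + 1 := by
    simp [List.take_add_one, h]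
  have h2 : D.semilength = (D.toList.take (a + 1)).count DyckStep.U +
      (D.toList.drop (a + 1)).count DyckStep.U := by
    rw [← List.count_append, List.take_append_drop]; rfl
  omega

theorem exists_tunnel {D : DyckWord} {a : ℕ} (h : D.toList[a]? = some DyckStep.U) :
    ∃ b, D.toList[b]? = some DyckStep.D ∧ IsTunnel D a (b + 1) := by
  have hal : a < D.toList.length := (List.getElem?_eq_some_iff.1 h).1
  have hex : ∃ k, a < k ∧ height D k ≤ height D a := by
    refine ⟨D.toList.length, hal, ?_⟩
    have h1 : height D D.toList.length = 0 := by
      simp [height, D.count_U_eq_count_D]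
    have h2 := D.count_D_le_count_U a
    rw [h1, height]; omega
  classical
  obtain ⟨h1, h2⟩ := Nat.find_spec hex
  have hmin : ∀ k, a < k → k < Nat.find hex → height D a < height D k := fun k hk hk' => by
    have := Nat.find_min hex hk'
    push Not at this
    exact this hk
  obtain ⟨b, hb⟩ : ∃ b, Nat.find hex = b + 1 := ⟨Nat.find hex - 1, by omega⟩
  rw [hb] at h1 h2 hmin
  have hab : a < b := by
    refine lt_of_le_of_ne (by omega) ?_
    rintro rfl
    rw [height_succ_U h] at h2; omega
  have h3 := hmin b hab (by omega)
  have hbD : D.toList[b]? = some DyckStep.D := by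
    cases hs : D.toList[b]? with
    | none => simp [height, List.take_add_one, hs] at h2 h3; omega
    | some s =>
      cases s with
      | U => rw [height_succ_U hs] at h2; omega
      | D => rfl
  have h4 := height_succ_D hbD
  exact ⟨b, hbD, h1, by omega, hmin⟩

theorem tunnel_unique_right {D : DyckWord} {a b c : ℕ} (hb : IsTunnel D a b)
    (hc : IsTunnel D a c) : b = c := by
  obtain ⟨b1, b2, b3⟩ := hb
  obtain ⟨c1, c2, c3⟩ := hc
  rcases lt_trichotomy b c with h | h | h
  · have := c3 b b1 h; omega
  · exact h
  · have := b3 c c1 h; omega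

theorem tunnel_unique_left {D : DyckWord} {a b c : ℕ} (hb : IsTunnel D a c)
    (hc : IsTunnel D b c) : a = b := by
  obtain ⟨b1, b2, b3⟩ := hb
  obtain ⟨c1, c2, c3⟩ := hc
  rcases lt_trichotomy a b with h | h | h
  · have := b3 b h c1; omega
  · exact h
  · have := c3 a h b1; omega

theorem exists_perm_linked {n : ℕ} (D : DyckWord) (hD : D.semilength = n) :
    ∃ τ : Equiv.Perm (Fin n), ∀ p q, τ p = q ↔ Linked D p q := by
  have hex : ∀ p : Fin n, ∃ q : Fin n, Linked D p q := by
    intro p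
    obtain ⟨a, h1, h2⟩ := exists_occ (s := DyckStep.U) (l := D.toList) (c := n - 1 - p)
      (by have : D.toList.count DyckStep.U = n := hD
          omega)
    obtain ⟨b, h3, h4⟩ := exists_tunnel h1
    have h5 : (D.toList.take b).count DyckStep.D < n := by
      have e1 : (D.toList.take (b + 1)).count DyckStep.D =
          (D.toList.take b).count DyckStep.D + 1 := by simp [List.take_add_one, h3]
      have e2 := (List.take_sublist (b + 1) D.toList).count_le DyckStep.D
      rw [← D.semilength_eq_count_D] at e2
      omega
    have := count_drop_U h1
    exact ⟨⟨_, h5⟩, a, b, h1, by omega, h3, rfl, h4⟩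
  choose f hf using hex
  have hr : ∀ {p q q' : ℕ}, Linked D p q → Linked D p q' → q = q' := by
    rintro p q q' ⟨a, b, h1, h2, h3, h4, h5⟩ ⟨a', b', h1', h2', h3', h4', h5'⟩
    have := count_drop_U h1
    have := count_drop_U h1'
    obtain rfl := occ_unique h1 h1' (by omega)
    have := tunnel_unique_right h5 h5'
    obtain rfl : b = b' := by omega
    omega
  have hl : ∀ {p p' q : ℕ}, Linked D p q → Linked D p' q → p = p' := by
    rintro p p' q ⟨a, b, h1, h2, h3, h4, h5⟩ ⟨a', b', h1', h2', h3', h4', h5'⟩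
    obtain rfl := occ_unique h3 h3' (by omega)
    obtain rfl := tunnel_unique_left h5 h5'
    omega
  have hinj : Function.Injective f := fun p p' h =>
    Fin.ext (hl (hf p) (by rw [h]; exact hf p'))
  refine ⟨Equiv.ofBijective f (Finite.injective_iff_bijective.1 hinj), fun p q => ?_⟩
  rw [Equiv.ofBijective_apply]
  exact ⟨fun h => h ▸ hf p, fun h => Fin.ext (hr (hf p) h)⟩

/-- The map `Φ⁻¹`: the permutation of a Dyck path `D` of semilength `n`, characterised by
`phiInv D hD p = q ↔ Linked D p q`. -/
noncomputable def phiInv {n : ℕ} (D : DyckWord) (hD : D.semilength = n) : Equiv.Perm (Fin n) :=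
  (exists_perm_linked D hD).choose

theorem phiInv_eq_iff {n : ℕ} (D : DyckWord) (hD : D.semilength = n) (p q : Fin n) :
    phiInv D hD p = q ↔ Linked D p q :=
  (exists_perm_linked D hD).choose_spec p q

/-- The Elizalde–Pak map `Θ = Φ⁻¹ ∘ Ψ` on 321-avoiding permutations of length `n`. -/
noncomputable def theta {n : ℕ} (σ : Avoiders n p321) : Equiv.Perm (Fin n) :=
  phiInv (psi σ) (semilength_psi σ)

end ElizaldePak

/-! Regard `σ` as a set of points in the `n × n` square, and attach to the vertex `(i, j)` the shape
of the tableau of the points in `[0, i) × [0, j)`. This is Fomin's growth diagram. Avoidance of 321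
leaves at most two tableau rows, of lengths `lpp` and `npt - lpp`, and `ght` is the difference of
these lengths. The path `Ψ(σ)` is the graph of `ght` along the outer sides of the square, from `(n,
0)` through `(n, n)` to `(0, n)` (`height_psi_left`, `height_psi_right`).

Both crossing numbers are split over `k`. For `σ`, `crs_of_avoids_321` gives the sum of the numbers
`#{i | i < k < σ i}`, that is, of `k - npt k (k + 1)`. For `τ = Θ(σ)`, the tunnels match the steps
of the path into noncrossing arcs, and the arcs with exactly one step in the window `[k + 1, 2n -
k)` are counted over all `k`. An arc is counted `2c + 1` times, where `c` is the number of crossings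
of `τ` in which it is the outer arc, so the total is `2 crs τ + n` (`sum_separated`). For a single
`k` the count is the sum of the heights at the ends of the window minus twice the least height
inside (`card_separated`).

It remains to see that this quantity is `2 #{i | i < k < σ i} + 1`, which is `exists_min_ght`. By
the local rules `ght` obeys a minimum principle, so its minimum on the outer boundary between `(n, k
+ 1)` and `(k, n)` equals its minimum on the two segments that join these vertices to `(k, k + 1)`.
There it is explicit, because the points in the two boxes bordering the corner form chains.

As for bijectivity, the noncrossing arcs force avoidance of 132. The permutation determines the
path, and the path determines `σ` by running the local rules backwards (`Grid.determined`).
Surjectivity is a counting argument, through an injection of the 132-avoiders into the 321-avoiders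
given by running extrema. -/

namespace ElizaldePak

/-! ### Last passage times -/

section Grid

open Classical in
/-- The greatest size of a chain of points of `X` in the rectangle `[0, i) × [0, j)`. -/
noncomputable def lpp (X : ℕ → ℕ → Prop) : ℕ → ℕ → ℕ
  | 0, _ => 0
  | _ + 1, 0 => 0
  | i + 1, j + 1 =>
    max (max (lpp X i (j + 1)) (lpp X (i + 1) j)) (if X i j then lpp X i j + 1 else 0)

open Classical in
/-- The number of points of `X` in the rectangle `[0, i) × [0, j)`. -/
noncomputable def npt (X : ℕ → ℕ → Prop) (i j : ℕ) : ℕ :=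
  ∑ x ∈ Finset.range i, ∑ y ∈ Finset.range j, if X x y then 1 else 0

variable {X : ℕ → ℕ → Prop}

@[simp] theorem lpp_zero_left (j : ℕ) : lpp X 0 j = 0 := by simp [lpp]

@[simp] theorem lpp_zero_right (i : ℕ) : lpp X i 0 = 0 := by cases i <;> simp [lpp]

theorem lpp_swap (i j : ℕ) : lpp (fun a b => X b a) j i = lpp X i j := by
  induction i generalizing j with
  | zero => simp
  | succ i ih =>
    induction j with
    | zero => simp
    | succ j ihj => rw [lpp, lpp, ih, ihj, ih, max_comm (lpp X i (j + 1))]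

theorem lpp_le_succ_left (i j : ℕ) : lpp X i j ≤ lpp X (i + 1) j := by
  cases j with
  | zero => simp
  | succ j => rw [lpp.eq_3]; exact (le_max_left _ _).trans (le_max_left _ _)

theorem lpp_le_succ_right (i j : ℕ) : lpp X i j ≤ lpp X i (j + 1) := by
  rw [← lpp_swap i j, ← lpp_swap i (j + 1)]; exact lpp_le_succ_left _ _

theorem lpp_mono {i i' j j' : ℕ} (hi : i ≤ i') (hj : j ≤ j') : lpp X i j ≤ lpp X i' j' :=
  (monotone_nat_of_le_succ (f := fun i => lpp X i j) (fun i => lpp_le_succ_left i j) hi).trans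
    (monotone_nat_of_le_succ (f := fun j => lpp X i' j) (fun j => lpp_le_succ_right i' j) hj)

theorem lpp_point {i j p z : ℕ} (h : X p z) (hp : p < i) (hz : z < j) :
    lpp X p z + 1 ≤ lpp X i j := by
  refine le_trans ?_ (lpp_mono (Nat.succ_le_of_lt hp) (Nat.succ_le_of_lt hz))
  rw [Nat.succ_eq_add_one, Nat.succ_eq_add_one, lpp.eq_3, if_pos h]
  exact le_max_right _ _

-- The last point of a longest chain. Most comparisons of `lpp` below follow by appending a point to
-- the chain or by locating this last point.
open Classical in
theorem exists_last {i j : ℕ} (h : 0 < lpp X i j) :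
    ∃ p z, p < i ∧ z < j ∧ X p z ∧ lpp X i j = lpp X p z + 1 := by
  induction i generalizing j with
  | zero => simp at h
  | succ i ih =>
    induction j with
    | zero => simp at h
    | succ j ihj =>
      have e : lpp X (i + 1) (j + 1) = max (max (lpp X i (j + 1)) (lpp X (i + 1) j))
        (if X i j then lpp X i j + 1 else 0) := by rw [lpp.eq_3]
      rcases max_choice (max (lpp X i (j + 1)) (lpp X (i + 1) j))
        (if X i j then lpp X i j + 1 else 0) with h1 | h1
      · rcases max_choice (lpp X i (j + 1)) (lpp X (i + 1) j) with h2 | h2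
        · rw [h1, h2] at e
          obtain ⟨p, z, a, b, c, d⟩ := ih (j := j + 1) (by omega)
          exact ⟨p, z, by omega, b, c, by omega⟩
        · rw [h1, h2] at e
          obtain ⟨p, z, a, b, c, d⟩ := ihj (by omega)
          exact ⟨p, z, a, by omega, c, by omega⟩
      · rw [h1] at e
        by_cases hX : X i j
        · rw [if_pos hX] at e
          exact ⟨i, j, by omega, by omega, hX, e⟩
        · rw [if_neg hX] at e; omega

theorem lpp_succ_left_eq_of_empty {i j : ℕ} (h : ∀ y < j, ¬ X i y) :
    lpp X (i + 1) j = lpp X i j := by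
  refine le_antisymm ?_ (lpp_le_succ_left i j)
  rcases Nat.eq_zero_or_pos (lpp X (i + 1) j) with h0 | h0
  · omega
  obtain ⟨p, z, a, b, c, d⟩ := exists_last h0
  have hp : p ≠ i := by rintro rfl; exact h z b c
  have := lpp_point c (show p < i by omega) b
  omega

theorem lpp_succ_right_eq_of_empty {i j : ℕ} (h : ∀ x < i, ¬ X x j) :
    lpp X i (j + 1) = lpp X i j := by
  rw [← lpp_swap i j, ← lpp_swap i (j + 1)]; exact lpp_succ_left_eq_of_empty h

theorem lpp_succ_left_le (i j : ℕ) : lpp X (i + 1) j ≤ lpp X i j + 1 := by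
  rcases Nat.eq_zero_or_pos (lpp X (i + 1) j) with h0 | h0
  · omega
  obtain ⟨p, z, a, b, c, d⟩ := exists_last h0
  have := lpp_mono (X := X) (show p ≤ i by omega) b.le
  omega

theorem npt_swap (i j : ℕ) : npt (fun a b => X b a) j i = npt X i j := Finset.sum_comm

@[simp] theorem npt_zero_left (j : ℕ) : npt X 0 j = 0 := by simp [npt]

@[simp] theorem npt_zero_right (i : ℕ) : npt X i 0 = 0 := by simp [npt]

theorem npt_succ_left_of_empty {i j : ℕ} (h : ∀ y < j, ¬ X i y) :
    npt X (i + 1) j = npt X i j := by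
  rw [npt, Finset.sum_range_succ, npt, Nat.add_eq_left]
  exact Finset.sum_eq_zero fun y hy => if_neg (h y (Finset.mem_range.1 hy))

theorem npt_succ_right_of_empty {i j : ℕ} (h : ∀ x < i, ¬ X x j) :
    npt X i (j + 1) = npt X i j := by
  rw [← npt_swap i j, ← npt_swap i (j + 1)]; exact npt_succ_left_of_empty h

/-- The graph of a 321-avoiding permutation of `{0, …, n - 1}`. -/
structure Grid (n : ℕ) (X : ℕ → ℕ → Prop) : Prop where
  lt : ∀ {i j}, X i j → i < n ∧ j < n
  total : ∀ i < n, ∃ j, X i j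
  onto : ∀ j < n, ∃ i, X i j
  right_unique : ∀ {i j j'}, X i j → X i j' → j = j'
  left_unique : ∀ {i i' j}, X i j → X i' j → i = i'
  avoid : ∀ {i j k a b c}, X i a → X j b → X k c → i < j → j < k → b < a → c < b → False

/-! ### Local rules of the growth diagram -/

namespace Grid

variable {n : ℕ}

theorem swap (g : Grid n X) : Grid n (fun a b => X b a) where
  lt h := (g.lt h).symm
  total := g.onto
  onto := g.total
  right_unique := g.left_unique
  left_unique := g.right_unique
  avoid h1 h2 h3 a b c d := g.avoid h3 h2 h1 d c b a

theorem npt_succ_left_of_mem (g : Grid n X) {i j y : ℕ} (h : X i y) (hy : y < j) :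
    npt X (i + 1) j = npt X i j + 1 := by
  rw [npt, Finset.sum_range_succ, npt, Nat.add_right_inj,
    Finset.sum_eq_single_of_mem y (Finset.mem_range.2 hy), if_pos h]
  intro z _ hz
  exact if_neg fun h' => hz (g.right_unique h' h)

theorem npt_right_full (g : Grid n X) {i : ℕ} (hi : i ≤ n) : npt X i n = i := by
  induction i with
  | zero => simp
  | succ i ih =>
    obtain ⟨j, hj⟩ := g.total i hi
    rw [g.npt_succ_left_of_mem hj (g.lt hj).2, ih (by omega)]

theorem npt_left_full (g : Grid n X) {j : ℕ} (hj : j ≤ n) : npt X n j = j := by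
  rw [← npt_swap]; exact g.swap.npt_right_full hj

theorem row_cases (g : Grid n X) (i j : ℕ) :
    ((∀ y < j, ¬ X i y) ∧ npt X (i + 1) j = npt X i j ∧ lpp X (i + 1) j = lpp X i j) ∨
    ((∃ y < j, X i y) ∧ npt X (i + 1) j = npt X i j + 1 ∧ lpp X i j ≤ lpp X (i + 1) j ∧
      lpp X (i + 1) j ≤ lpp X i j + 1) := by
  by_cases h : ∃ y < j, X i y
  · obtain ⟨y, hy, h⟩ := h
    exact Or.inr ⟨⟨y, hy, h⟩, g.npt_succ_left_of_mem h hy, lpp_le_succ_left _ _,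
      lpp_succ_left_le _ _⟩
  · push Not at h
    exact Or.inl ⟨h, npt_succ_left_of_empty h, lpp_succ_left_eq_of_empty h⟩

theorem col_cases (g : Grid n X) (i j : ℕ) :
    ((∀ x < i, ¬ X x j) ∧ npt X i (j + 1) = npt X i j ∧ lpp X i (j + 1) = lpp X i j) ∨
    ((∃ x < i, X x j) ∧ npt X i (j + 1) = npt X i j + 1 ∧ lpp X i j ≤ lpp X i (j + 1) ∧
      lpp X i (j + 1) ≤ lpp X i j + 1) := by
  have := g.swap.row_cases j i
  simpa only [npt_swap, lpp_swap] using this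

/-- If row `i` has a point on the left of column `j` and column `j` has a point below row `i`, then
one of the two points increases the last passage time. -/
theorem lpp_ne (g : Grid n X) {i j x y : ℕ} (hy : y < j) (h : X i y) (hx : x < i) (h' : X x j) :
    lpp X i j < lpp X (i + 1) j ∨ lpp X i j < lpp X i (j + 1) := by
  -- The last point `(p, z)` of a longest chain in `[0, i) × [0, j)` cannot precede `(x, j)` or `(i,
  -- y)`, as either would then lengthen the chain. So it lies strictly between them and completes a
  -- 321.
  by_contra! hc
  have h1 := lpp_point h (Nat.lt_add_one i) hy
  obtain ⟨p, z, a, b, c, d⟩ := exists_last (X := X) (i := i) (j := j) (by omega)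
  rcases lt_trichotomy p x with hpx | rfl | hpx
  · have := lpp_point c hpx b
    have := lpp_point h' hx (Nat.lt_add_one j)
    omega
  · have := g.right_unique c h'; omega
  rcases lt_trichotomy z y with hzy | rfl | hzy
  · have := lpp_point c a hzy
    omega
  · have := g.left_unique c h; omega
  · exact g.avoid h' c h hpx a b hzy

theorem lpp_succ_succ_of_not (i j : ℕ) (h : ¬ X i j) :
    lpp X (i + 1) (j + 1) = max (lpp X i (j + 1)) (lpp X (i + 1) j) := by
  rw [lpp.eq_3, if_neg h, Nat.max_zero]

theorem lpp_succ_succ_of_mem (g : Grid n X) {i j : ℕ} (h : X i j) :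
    lpp X i (j + 1) = lpp X i j ∧ lpp X (i + 1) j = lpp X i j ∧
      lpp X (i + 1) (j + 1) = lpp X i j + 1 := by
  have h1 : lpp X i (j + 1) = lpp X i j :=
    lpp_succ_right_eq_of_empty fun x hx h' => by have := g.left_unique h h'; omega
  have h2 : lpp X (i + 1) j = lpp X i j :=
    lpp_succ_left_eq_of_empty fun y hy h' => by have := g.right_unique h h'; omega
  refine ⟨h1, h2, ?_⟩
  rw [lpp.eq_3, h1, h2, if_pos h]; simp

theorem npt_succ_succ_of_mem (g : Grid n X) {i j : ℕ} (h : X i j) :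
    npt X i (j + 1) = npt X i j ∧ npt X (i + 1) j = npt X i j ∧
      npt X (i + 1) (j + 1) = npt X i j + 1 := by
  have h1 : npt X i (j + 1) = npt X i j :=
    npt_succ_right_of_empty fun x hx h' => by have := g.left_unique h h'; omega
  refine ⟨h1, npt_succ_left_of_empty fun y hy h' => by
    have := g.right_unique h h'; omega, ?_⟩
  rw [g.npt_succ_left_of_mem h (Nat.lt_succ_self j), h1]

/-- The local rule: the four values around a cell without a point. -/
theorem cell_cases (g : Grid n X) {i j : ℕ} (h : ¬ X i j) :
    (npt X (i + 1) j = npt X i j ∧ npt X (i + 1) (j + 1) = npt X i (j + 1) ∧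
      lpp X (i + 1) j = lpp X i j ∧ lpp X (i + 1) (j + 1) = lpp X i (j + 1)) ∨
    (npt X i (j + 1) = npt X i j ∧ npt X (i + 1) (j + 1) = npt X (i + 1) j ∧
      lpp X i (j + 1) = lpp X i j ∧ lpp X (i + 1) (j + 1) = lpp X (i + 1) j) ∨
    (npt X (i + 1) j = npt X i j + 1 ∧ npt X i (j + 1) = npt X i j + 1 ∧
      npt X (i + 1) (j + 1) = npt X i j + 2 ∧ lpp X (i + 1) (j + 1) = lpp X i j + 1 ∧
      lpp X i j ≤ lpp X (i + 1) j ∧ lpp X i j ≤ lpp X i (j + 1) ∧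
      lpp X (i + 1) (j + 1) = max (lpp X i (j + 1)) (lpp X (i + 1) j)) := by
  rcases g.row_cases i j with ⟨r1, r2, r3⟩ | ⟨⟨y, hy, r1⟩, r2, r3, r4⟩
  · have : ∀ y < j + 1, ¬ X i y := fun y hy => by
      rcases Nat.lt_succ_iff_lt_or_eq.1 hy with h' | rfl
      · exact r1 y h'
      · exact h
    exact Or.inl ⟨r2, npt_succ_left_of_empty this, r3, lpp_succ_left_eq_of_empty this⟩
  rcases g.col_cases i j with ⟨c1, c2, c3⟩ | ⟨⟨x, hx, c1⟩, c2, c3, c4⟩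
  · have : ∀ x < i + 1, ¬ X x j := fun x hx => by
      rcases Nat.lt_succ_iff_lt_or_eq.1 hx with h' | rfl
      · exact c1 x h'
      · exact h
    exact Or.inr (Or.inl ⟨c2, npt_succ_right_of_empty this, c3, lpp_succ_right_eq_of_empty this⟩)
  have e := lpp_succ_succ_of_not i j h
  have e' := g.npt_succ_left_of_mem (j := j + 1) r1 (by omega)
  have := g.lpp_ne hy r1 hx c1
  refine Or.inr (Or.inr ⟨r2, c2, by omega, ?_, r3, c3, e⟩)
  rw [e]
  rcases max_cases (lpp X i (j + 1)) (lpp X (i + 1) j) with h | h <;> omega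

/-- The height of the vertex `(i, j)` of the growth diagram: the difference of the lengths of the
two rows. -/
noncomputable def _root_.ElizaldePak.ght (X : ℕ → ℕ → Prop) (i j : ℕ) : ℤ :=
  2 * (lpp X i j : ℤ) - npt X i j

/-- Around a cell with a point three corners have equal height and the far one is higher by one.
Around any other cell, either two parallel edges carry the same heights, or two opposite corners
have the same height. Hence neither the far nor the near corner is lower than all the other three.
-/
theorem le_ght_succ_succ (g : Grid n X) {i j : ℕ} {m : ℤ} (h : m ≤ ght X i j)
    (h1 : m ≤ ght X (i + 1) j) (h2 : m ≤ ght X i (j + 1)) : m ≤ ght X (i + 1) (j + 1) := by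
  simp only [ght] at *
  by_cases hX : X i j
  · have := g.lpp_succ_succ_of_mem hX
    have := g.npt_succ_succ_of_mem hX
    omega
  · rcases g.cell_cases hX with h | h | h <;> omega

theorem le_ght_of_succ_succ (g : Grid n X) {i j : ℕ} {m : ℤ} (h : m ≤ ght X (i + 1) (j + 1))
    (h1 : m ≤ ght X (i + 1) j) (h2 : m ≤ ght X i (j + 1)) : m ≤ ght X i j := by
  simp only [ght] at *
  by_cases hX : X i j
  · have := g.lpp_succ_succ_of_mem hX
    have := g.npt_succ_succ_of_mem hX
    omega
  · rcases g.cell_cases hX with h | h | h <;> omega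

/-- With `le_ght_inner`, a minimum principle on `[a, n] × [b, n]`: a lower bound on the two inner
sides holds throughout, and so does one on the two outer sides. Hence both pairs of sides have the
same minimum. -/
theorem le_ght_outer (g : Grid n X) {a b : ℕ} {m : ℤ} (h1 : ∀ i, a ≤ i → i ≤ n → m ≤ ght X i b)
    (h2 : ∀ j, b ≤ j → j ≤ n → m ≤ ght X a j) {i j : ℕ} (ha : a ≤ i) (hi : i ≤ n) (hb : b ≤ j)
    (hj : j ≤ n) : m ≤ ght X i j := by
  induction i, ha using Nat.le_induction generalizing j with
  | base => exact h2 j hb hj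
  | succ i ha ih =>
    induction j, hb using Nat.le_induction with
    | base => exact h1 _ (by omega) hi
    | succ j hb ihj =>
      exact g.le_ght_succ_succ (ih (by omega) (by omega) (by omega)) (ihj (by omega))
        (ih (by omega) (by omega) (by omega))

theorem le_ght_inner (g : Grid n X) {a b : ℕ} {m : ℤ} (h1 : ∀ i, a ≤ i → i ≤ n → m ≤ ght X i n)
    (h2 : ∀ j, b ≤ j → j ≤ n → m ≤ ght X n j) {i j : ℕ} (ha : a ≤ i) (hi : i ≤ n) (hb : b ≤ j)
    (hj : j ≤ n) : m ≤ ght X i j := by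
  induction hi using Nat.decreasingInduction generalizing j with
  | self => exact h2 j hb hj
  | of_succ i hi ih =>
    induction hj using Nat.decreasingInduction with
    | self => exact h1 _ ha (by omega)
    | of_succ j hj ihj =>
      exact g.le_ght_of_succ_succ (ih (by omega) (by omega) (by omega))
        (ih (by omega) (by omega) (by omega)) (ihj (by omega))

/-- The last passage times on the outer sides of the square determine the permutation. -/
theorem determined {Y : ℕ → ℕ → Prop} (g : Grid n X) (g' : Grid n Y)
    (h1 : ∀ i ≤ n, lpp X i n = lpp Y i n) (h2 : ∀ j ≤ n, lpp X n j = lpp Y n j) {i j : ℕ}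
    (hi : i < n) (hj : j < n) : X i j ↔ Y i j := by
  -- A cell contains a point exactly when `lpp` at its far corner exceeds both adjacent values, so
  -- three corners decide it. The fourth corner then follows from the local rule, by induction
  -- inwards from the outer sides.
  have cell : ∀ {i j : ℕ}, lpp X (i + 1) j = lpp Y (i + 1) j → lpp X i (j + 1) = lpp Y i (j + 1) →
      lpp X (i + 1) (j + 1) = lpp Y (i + 1) (j + 1) → (X i j ↔ Y i j) := by
    intro i j e1 e2 e3
    by_cases hX : X i j
    · have := g.lpp_succ_succ_of_mem hX
      refine ⟨fun _ => ?_, fun _ => hX⟩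
      by_contra hY
      have := lpp_succ_succ_of_not i j hY
      rcases max_cases (lpp Y i (j + 1)) (lpp Y (i + 1) j) with h | h <;> omega
    · refine ⟨fun h => absurd h hX, fun hY => ?_⟩
      have := g'.lpp_succ_succ_of_mem hY
      have := lpp_succ_succ_of_not i j hX
      rcases max_cases (lpp X i (j + 1)) (lpp X (i + 1) j) with h | h <;> omega
  have key : ∀ {i j : ℕ}, i ≤ n → j ≤ n → lpp X i j = lpp Y i j ∧ npt X i j = npt Y i j := by
    intro i j hi hj
    induction hi using Nat.decreasingInduction generalizing j with
    | self => exact ⟨h2 j hj, by rw [g.npt_left_full hj, g'.npt_left_full hj]⟩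
    | of_succ i hi ih =>
      induction hj using Nat.decreasingInduction with
      | self =>
        exact ⟨h1 i hi.le, by rw [g.npt_right_full hi.le, g'.npt_right_full hi.le]⟩
      | of_succ j hj ihj =>
        obtain ⟨a1, a2⟩ := ih (j := j) (by omega)
        obtain ⟨b1, b2⟩ := ih (j := j + 1) (by omega)
        obtain ⟨c1, c2⟩ := ihj
        by_cases hX : X i j
        · have hY := (cell a1 c1 b1).1 hX
          have := g.lpp_succ_succ_of_mem hX
          have := g.npt_succ_succ_of_mem hX
          have := g'.lpp_succ_succ_of_mem hY
          have := g'.npt_succ_succ_of_mem hY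
          omega
        · have hY := fun h => hX ((cell a1 c1 b1).2 h)
          rcases g.cell_cases hX with h | h | h <;> rcases g'.cell_cases hY with h' | h' | h' <;>
            omega
  exact cell (key (by omega) (by omega)).1 (key (by omega) (by omega)).1
    (key (by omega) (by omega)).1

end Grid

end Grid

/-! ### The least height on the boundary between two vertices -/

section Grid

variable {X : ℕ → ℕ → Prop}

namespace Grid

variable {n : ℕ}

/-- The second tableau row, of length `npt - lpp`, never shrinks. -/
theorem lpp_npt_lipschitz (g : Grid n X) {i i' : ℕ} (h : i ≤ i') (j : ℕ) :
    lpp X i' j + npt X i j ≤ lpp X i j + npt X i' j := by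
  induction i', h using Nat.le_induction with
  | base => exact le_rfl
  | succ m hm ih => rcases g.row_cases m j with h | h <;> omega

theorem npt_mono_left (g : Grid n X) {i i' : ℕ} (h : i ≤ i') (j : ℕ) :
    npt X i j ≤ npt X i' j := by
  have := g.lpp_npt_lipschitz h j
  have := lpp_mono (X := X) h (le_refl j)
  omega

theorem npt_box_empty (g : Grid n X) {t m z w : ℕ} (htm : t ≤ m) (hzw : z ≤ w)
    (h : ∀ p v, t ≤ p → p < m → z ≤ v → v < w → ¬ X p v) :
    npt X m w + npt X t z = npt X m z + npt X t w := by
  induction m, htm using Nat.le_induction with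
  | base => omega
  | succ m hm ih =>
    have ih := ih fun p v h1 h2 => h p v h1 (by omega)
    have h := fun v => h m v hm (by omega)
    by_cases hz : ∃ y < z, X m y
    · obtain ⟨y, hy, hX⟩ := hz
      rw [g.npt_succ_left_of_mem hX hy, g.npt_succ_left_of_mem hX (hy.trans_le hzw)]
      omega
    · push Not at hz
      rw [npt_succ_left_of_empty hz, npt_succ_left_of_empty fun y hy => ?_]
      · exact ih
      · by_cases hyz : y < z
        · exact hz y hyz
        · exact h y (by omega) hy

/-- If the points of a box form a chain, it extends the chains of the rectangle below the box. -/
theorem lpp_add_chain (g : Grid n X) {t m b w : ℕ} (htm : t ≤ m) (hbw : b ≤ w)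
    (h : ∀ p p' v v', t ≤ p → p < p' → p' < m → b ≤ v → b ≤ v' → X p v → X p' v' → v < v') :
    lpp X t b + npt X m w + npt X t b ≤ lpp X m w + npt X m b + npt X t w := by
  induction m, htm using Nat.le_induction generalizing w with
  | base => have := lpp_mono (X := X) (le_refl t) hbw; omega
  | succ m hm ih =>
    have ih := fun {w : ℕ} (hbw : b ≤ w) =>
      ih (w := w) hbw fun p p' v v' h1 h2 h3 => h p p' v v' h1 h2 (by omega)
    by_cases hz : ∃ z, z < w ∧ X m z
    · obtain ⟨z, hzw, hX⟩ := hz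
      rw [g.npt_succ_left_of_mem hX hzw]
      by_cases hbz : b ≤ z
      · have h1 := ih hbz
        have h2 := g.npt_box_empty hm hzw.le fun p v h1 h2 h3 _ h5 => by
          have := h p m v z h1 h2 (by omega) (by omega) hbz h5 hX
          omega
        have h3 := lpp_point hX (Nat.lt_add_one m) hzw
        rw [npt_succ_left_of_empty fun y hy h' => by have := g.right_unique hX h'; omega]
        omega
      · have := ih hbw
        rw [g.npt_succ_left_of_mem hX (not_le.1 hbz)]
        have := lpp_le_succ_left (X := X) m w
        omega
    · push Not at hz
      have := ih hbw
      rw [npt_succ_left_of_empty hz, npt_succ_left_of_empty fun y hy => hz y (by omega)]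
      have := lpp_le_succ_left (X := X) m w
      omega

/-- The points of `[0, a) × [b, n)` form a chain. -/
def _root_.ElizaldePak.Increasing (X : ℕ → ℕ → Prop) (a b : ℕ) : Prop :=
  ∀ p p' v v', p < p' → p' < a → b ≤ v → b ≤ v' → X p v → X p' v' → v < v'

/-- Take the first row `t` with a point in columns `≥ b`. Were `lpp X t b` equal to `lpp X a b`, a
longest chain of `[0, t) × [0, b)` followed by all points of the box would contradict the strict
inequality. -/
theorem exists_lpp_lt (g : Grid n X) {a b : ℕ} (ha : a ≤ n) (hb : b ≤ n)
    (hinc : Increasing X a b) (h : lpp X a n + npt X a b < lpp X a b + a) :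
    ∃ t y, t < a ∧ b ≤ y ∧ X t y ∧ lpp X t b < lpp X a b := by
  by_cases hex : ∃ t, t < a ∧ ∃ y, b ≤ y ∧ X t y
  · classical
    obtain ⟨h1, y, h2, h3⟩ := Nat.find_spec hex
    have hmin := fun m hm => Nat.find_min (m := m) hex hm
    set t := Nat.find hex
    refine ⟨t, y, h1, h2, h3, ?_⟩
    by_contra hc
    have e1 := g.lpp_add_chain h1.le hb fun p p' v v' _ hp hp' => hinc p p' v v' hp hp'
    have e2 := g.npt_box_empty (Nat.zero_le t) hb fun p v _ hp hv _ h' =>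
      hmin p hp ⟨by omega, v, hv, h'⟩
    rw [g.npt_right_full ha] at e1
    simp at e2
    omega
  · push Not at hex
    have e2 := g.npt_box_empty (Nat.zero_le a) hb fun p v _ hp hv _ h' => hex p hp v hv h'
    rw [g.npt_right_full ha] at e2
    have := lpp_mono (X := X) (le_refl a) hb
    simp at e2
    omega

/-- The bound of `le_ght_left` is attained: stop at the last `j` before `lpp X a` first increases
beyond its value at `b`. The point in column `j` that causes the increase lies above a longest
chain, and every later point of the box continues that chain. So from `j` on only the first tableau
row grows. -/
theorem exists_ght_le (g : Grid n X) {a b : ℕ} (ha : a ≤ n) (hb : b ≤ n)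
    (hinc : Increasing X a b) :
    ∃ j, b ≤ j ∧ j ≤ n ∧ ght X a j ≤ (lpp X a b : ℤ) + lpp X a n - a := by
  by_cases hex : ∃ j, b ≤ j ∧ j < n ∧ lpp X a b < lpp X a (j + 1)
  · classical
    obtain ⟨h1, h2, h3⟩ := Nat.find_spec hex
    have hmin := fun m hm => Nat.find_min (m := m) hex hm
    generalize Nat.find hex = j at *
    have e0 : lpp X a j = lpp X a b := by
      rcases Nat.eq_or_lt_of_le h1 with h | h
      · rw [h]
      · have := lpp_mono (X := X) (le_refl a) h1
        have e : j - 1 + 1 = j := by omega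
        by_contra hne
        exact hmin (j - 1) (by omega) ⟨by omega, by omega, by rw [e]; omega⟩
    obtain ⟨t, z, ht, hz, hX, e1⟩ := exists_last (X := X) (i := a) (j := j + 1) (by omega)
    have hzj : z = j := by
      by_contra hne
      have := lpp_point hX ht (show z < j by omega)
      omega
    rw [hzj] at hX e1
    have e2 := lpp_mono (X := X) ht.le (le_refl j)
    have e3 := g.lpp_add_chain ht.le h2.le fun p p' v v' _ hp hp' hv hv' =>
      hinc p p' v v' hp hp' (by omega) (by omega)
    have e4 := g.npt_box_empty (Nat.zero_le t) h2.le fun p v _ hp hv _ h' => by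
      have := hinc p t v j hp ht (by omega) (by omega) h' hX
      omega
    rw [g.npt_right_full ha] at e3
    simp at e4
    refine ⟨j, h1, h2.le, ?_⟩
    rw [ght]; omega
  · push Not at hex
    have e0 : lpp X a n = lpp X a b := by
      rcases Nat.eq_or_lt_of_le hb with h | h
      · rw [h]
      · have := hex (n - 1) (by omega) (by omega)
        have e : n - 1 + 1 = n := by omega
        rw [e] at this
        have := lpp_mono (X := X) (le_refl a) hb
        omega
    exact ⟨n, hb, le_rfl, by rw [ght, g.npt_right_full ha]; omega⟩

/-- The height is the first length minus the second. Along the segment the first is at least its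
initial value, and the second is at most its final one. -/
theorem le_ght_right (g : Grid n X) {a b i : ℕ} (hb : b ≤ n) (h : a ≤ i) (hi : i ≤ n) :
    (lpp X a b : ℤ) + lpp X n b - b ≤ ght X i b := by
  have h1 := lpp_mono (X := X) h (le_refl b)
  have h2 := g.lpp_npt_lipschitz hi b
  rw [g.npt_left_full hb] at h2
  rw [ght]; omega

theorem ght_swap (i j : ℕ) : ght (fun a b => X b a) j i = ght X i j := by
  rw [ght, ght, lpp_swap, npt_swap]

theorem le_ght_left (g : Grid n X) {a b j : ℕ} (ha : a ≤ n) (h : b ≤ j) (hj : j ≤ n) :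
    (lpp X a b : ℤ) + lpp X a n - a ≤ ght X a j := by
  have := g.swap.le_ght_right ha h hj
  simpa only [lpp_swap, ght_swap] using this

/-- By avoidance, a descent in this box leaves no point in rows `≥ k` and columns `≤ k`. The `k + 1`
columns `0, …, k` would then have all their points in only `k` rows. -/
theorem increasing_left (g : Grid n X) {k : ℕ} (hk : k < n) : Increasing X k (k + 1) := by
  intro p p' v v' hp hp' hv hv' hX hX'
  by_contra hc
  have hne : v ≠ v' := by rintro rfl; have := g.left_unique hX hX'; omega
  have h1 := g.npt_left_full (show k + 1 ≤ n from hk)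
  suffices npt X n (k + 1) ≤ npt X k (k + 1) by
    have h2 := g.npt_right_full (show k ≤ n by omega)
    have h3 : npt X k (k + 1) ≤ npt X k n := by
      rw [← npt_swap k (k + 1), ← npt_swap k n]
      exact g.swap.npt_mono_left hk k
    omega
  refine le_of_eq ?_
  have := g.npt_box_empty (show k ≤ n by omega) (Nat.zero_le (k + 1)) fun q u hq _ _ hu h => by
    exact g.avoid hX hX' h hp (by omega) (by omega) (by omega)
  simpa using this

/-- A descent here empties the opposite box, so all `k` points of the rows `< k` lie in the first `k
+ 1` columns. With the two points of the descent this makes `k + 2` points in `k + 1` columns. -/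
theorem increasing_right (g : Grid n X) {k : ℕ} (hk : k < n) :
    Increasing (fun a b => X b a) (k + 1) k := by
  intro v v' p p' hv hv' hp hp' hX hX'
  by_contra hc
  have hne : p ≠ p' := by rintro rfl; have := g.right_unique hX hX'; omega
  have h1 := g.npt_left_full (show k + 1 ≤ n from hk)
  have h2 := g.npt_right_full (show k ≤ n by omega)
  have h3 : npt X k n = npt X k (k + 1) := by
    have := g.npt_box_empty (Nat.zero_le k) (show k + 1 ≤ n from hk) fun q u _ hq hu _ h =>
      g.avoid h hX' hX (by omega) (by omega) (by omega) (by omega)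
    simpa using this
  have e1 := g.npt_mono_left (show k ≤ p' by omega) (k + 1)
  have e2 := g.npt_succ_left_of_mem hX' (show v' < k + 1 from hv')
  have e3 := g.npt_mono_left (show p' + 1 ≤ p by omega) (k + 1)
  have e4 := g.npt_succ_left_of_mem hX (show v < k + 1 by omega)
  have e5 := g.npt_mono_left (show p + 1 ≤ n from (g.lt hX).1) (k + 1)
  omega

/-- The least height between the vertices `(n, k + 1)` and `(k, n)` of the outer sides of the
square. -/
theorem exists_min_ght (g : Grid n X) {k : ℕ} (hk : k < n) :
    ∃ M : ℤ, (∀ i, k ≤ i → i ≤ n → M ≤ ght X i n) ∧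
      (∀ j, k + 1 ≤ j → j ≤ n → M ≤ ght X n j) ∧
      ((∃ i, k ≤ i ∧ i ≤ n ∧ ght X i n ≤ M) ∨ (∃ j, k + 1 ≤ j ∧ j ≤ n ∧ ght X n j ≤ M)) ∧
      ght X n (k + 1) + ght X k n - 2 * M = 2 * ((k : ℤ) - npt X k (k + 1)) + 1 := by
  have hk' : k + 1 ≤ n := hk
  have hk0 : k ≤ n := hk.le
  have il := g.increasing_left hk
  have ir := g.increasing_right hk
  obtain ⟨jl, l1, l2, l3⟩ := g.exists_ght_le hk0 hk' il
  obtain ⟨jr, r1, r2, r3⟩ := g.swap.exists_ght_le hk' hk0 ir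
  have wl := g.exists_lpp_lt hk0 hk' il
  have wr := g.swap.exists_lpp_lt hk' hk0 ir
  simp only [lpp_swap, npt_swap, ght_swap] at r3 wr
  have kl := g.lpp_npt_lipschitz hk0 (k + 1)
  rw [g.npt_left_full hk'] at kl
  have kr := g.swap.lpp_npt_lipschitz hk' k
  simp only [lpp_swap, npt_swap] at kr
  rw [g.npt_right_full hk0] at kr
  -- If both bounds were strict, `exists_lpp_lt` would give a point in each of the two boxes. The
  -- last point of a longest chain in the corner rectangle would then lie between them and form a
  -- 321.
  have hor : lpp X k n + npt X k (k + 1) = lpp X k (k + 1) + k ∨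
      lpp X n (k + 1) + npt X k (k + 1) = lpp X k (k + 1) + (k + 1) := by
    by_contra! hc
    obtain ⟨t, j, t1, t2, t3, t4⟩ := wl (by omega)
    obtain ⟨v, i, v1, v2, v3, v4⟩ := wr (by omega)
    obtain ⟨p, w, q1, q2, q3, q4⟩ := exists_last (X := X) (i := k) (j := k + 1) (by omega)
    rcases lt_trichotomy p t with h | rfl | h
    · have := lpp_point q3 h q2; omega
    · have := g.right_unique q3 t3; omega
    rcases lt_trichotomy w v with h' | rfl | h'
    · have := lpp_point q3 q1 h'; omega
    · have := g.left_unique q3 v3; omega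
    · exact g.avoid t3 q3 v3 h (by omega) (by omega) h'
  have bl := fun j => g.le_ght_left (a := k) (b := k + 1) (j := j) hk0
  have br := fun i => g.le_ght_right (a := k) (b := k + 1) (i := i) hk'
  have key : ∀ M : ℤ,
      M ≤ (lpp X k (k + 1) : ℤ) + lpp X k n - k →
      M ≤ (lpp X k (k + 1) : ℤ) + lpp X n (k + 1) - (k + 1 : ℕ) →
      ((lpp X k (k + 1) : ℤ) + lpp X k n - k ≤ M ∨
        (lpp X k (k + 1) : ℤ) + lpp X n (k + 1) - (k + 1 : ℕ) ≤ M) →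
      (∀ i, k ≤ i → i ≤ n → M ≤ ght X i n) ∧
      (∀ j, k + 1 ≤ j → j ≤ n → M ≤ ght X n j) ∧
      ((∃ i, k ≤ i ∧ i ≤ n ∧ ght X i n ≤ M) ∨ (∃ j, k + 1 ≤ j ∧ j ≤ n ∧ ght X n j ≤ M)) := by
    intro M m1 m2 m3
    have outer := fun {i j : ℕ} => g.le_ght_outer (a := k) (b := k + 1) (m := M) (i := i) (j := j)
      (fun i h h' => m2.trans (br i h h')) (fun j h h' => m1.trans (bl j h h'))
    refine ⟨fun i h h' => outer h h' hk' le_rfl, fun j h h' => outer hk0 le_rfl h h', ?_⟩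
    -- Otherwise `M + 1` bounds the outer sides from below, hence also the inner sides, where one
    -- arm attains a value at most `M`.
    by_contra! hc
    have inner := fun {i j : ℕ} => g.le_ght_inner (a := k) (b := k + 1) (m := M + 1) (i := i)
      (j := j) (fun i h h' => hc.1 i h h') (fun j h h' => hc.2 j h h')
    rcases m3 with h | h
    · have := inner (le_refl k) hk0 l1 l2; omega
    · have := inner r1 r2 (le_refl (k + 1)) hk'; omega
  have e1 : ght X n (k + 1) = 2 * lpp X n (k + 1) - (k + 1 : ℕ) := by
    rw [ght, g.npt_left_full hk']
  have e2 : ght X k n = 2 * lpp X k n - k := by rw [ght, g.npt_right_full hk0]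
  -- The minima on the two arms are `L + A - k` and `L + B - (k + 1)`, with `L = lpp X k (k + 1)`,
  -- `A = lpp X k n`, `B = lpp X n (k + 1)`. For `N = npt X k (k + 1)` one has `A + N ≤ L + k` and
  -- `B + N ≤ L + k + 1`, and `hor` makes one of these an equality, so the smaller minimum is `N -
  -- 2k - 1 + A + B`.
  refine ⟨(npt X k (k + 1) : ℤ) - 2 * k - 1 + lpp X k n + lpp X n (k + 1), ?_⟩
  obtain ⟨k1, k2, k3⟩ := key ((npt X k (k + 1) : ℤ) - 2 * k - 1 + lpp X k n + lpp X n (k + 1))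
    (by omega) (by omega) (by omega)
  exact ⟨k1, k2, k3, by rw [e1, e2]; push_cast; ring⟩

end Grid

end Grid

/-! ### Row lengths of the tableaux as last passage times -/

theorem rsk_append (w : List ℕ) (x : ℕ) : rsk (w ++ [x]) = rskStep (rsk w) (x, w.length) := by
  simp [rsk, List.zipIdx_append]

theorem cnt_eq_zero_of_forall {v : ℕ} {r : List ℕ} (h : ∀ z ∈ r, v ≤ z) : cnt v r = 0 := by
  rw [cnt, List.countP_eq_zero]
  intro z hz
  have := h z hz
  simp; omega

/-- This is the recursion of `Grid.lpp_succ_of_mem`: a chain of values below `v` either avoids the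
new letter `x` or ends in it. -/
theorem cnt_rowInsert {x : ℕ} {r : List ℕ} (hr : r.Pairwise (· < ·)) (hx : x ∉ r) (v : ℕ) :
    cnt v (rowInsert x r).1 = if x < v then max (cnt v r) (cnt x r + 1) else cnt v r := by
  have ne : ∀ z ∈ r, z ≠ x := fun z hz h => hx (h ▸ hz)
  cases hb : (rowInsert x r).2 with
  | none =>
    obtain ⟨e, hle⟩ := rowInsert_none hb
    have hlt : ∀ z ∈ r, z < x := fun z hz => lt_of_le_of_ne (hle z hz) (ne z hz)
    rw [e, cnt_append, cnt_cons]
    by_cases hv : x < v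
    · rw [if_pos hv, if_pos hv, cnt_of_forall hlt, cnt_of_forall fun z hz => (hlt z hz).trans hv]
      simp [cnt]
    · simp [hv, cnt]
  | some y =>
    obtain ⟨s, t, e, e', hxy, hs⟩ := rowInsert_some hb
    have hlt : ∀ z ∈ s, z < x := fun z hz =>
      lt_of_le_of_ne (hs z hz) (ne z (by rw [e]; simp [hz]))
    rw [e, List.pairwise_append, List.pairwise_cons] at hr
    obtain ⟨-, ⟨h2, -⟩, -⟩ := hr
    rw [e', e, cnt_append, cnt_append, cnt_append, cnt_cons, cnt_cons, cnt_cons]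
    have c1 : cnt x t = 0 := cnt_eq_zero_of_forall fun z hz => by have := h2 z hz; omega
    rw [c1, if_neg (show ¬ y < x by omega), cnt_of_forall hlt]
    by_cases hv : x < v
    · rw [if_pos hv, if_pos hv, cnt_of_forall fun z hz => (hlt z hz).trans hv]
      by_cases hy : y < v
      · rw [if_pos hy]; omega
      · rw [if_neg hy, cnt_eq_zero_of_forall fun z hz => by have := h2 z hz; omega]; omega
    · rw [if_neg hv, if_neg hv, if_neg (show ¬ y < v by omega)]

theorem rowInsert_sorted {x : ℕ} {r : List ℕ} (hr : r.Pairwise (· < ·)) (hx : x ∉ r) :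
    (rowInsert x r).1.Pairwise (· < ·) := by
  have ne : ∀ z ∈ r, z ≠ x := fun z hz h => hx (h ▸ hz)
  cases hb : (rowInsert x r).2 with
  | none =>
    obtain ⟨e, hle⟩ := rowInsert_none hb
    rw [e, List.pairwise_append]
    refine ⟨hr, by simp, fun z hz y hy => ?_⟩
    rw [List.mem_singleton.1 hy]
    exact lt_of_le_of_ne (hle z hz) (ne z hz)
  | some y =>
    obtain ⟨s, t, e, e', hxy, hs⟩ := rowInsert_some hb
    have hlt : ∀ z ∈ s, z < x := fun z hz =>
      lt_of_le_of_ne (hs z hz) (ne z (by rw [e]; simp [hz]))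
    rw [e, List.pairwise_append, List.pairwise_cons] at hr
    obtain ⟨h1, ⟨h2, h3⟩, -⟩ := hr
    rw [e', List.pairwise_append, List.pairwise_cons]
    refine ⟨h1, ⟨fun z hz => hxy.trans (h2 z hz), h3⟩, fun z hz u hu => ?_⟩
    rcases List.mem_cons.1 hu with rfl | hu
    · exact hlt z hz
    · exact (hlt z hz).trans (hxy.trans (h2 u hu))

theorem mem_rowInsert {x z : ℕ} {r : List ℕ} (h : z ∈ (rowInsert x r).1) : z = x ∨ z ∈ r := by
  cases hb : (rowInsert x r).2 with
  | none =>
    rw [(rowInsert_none hb).1] at h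
    simpa [or_comm] using h
  | some y =>
    obtain ⟨s, t, e, e', -, -⟩ := rowInsert_some hb
    rw [e'] at h
    rw [e]
    simp at h ⊢
    tauto

theorem row_zero_rsk_append (w : List ℕ) (x : ℕ) :
    row 0 (rsk (w ++ [x])).1 = (rowInsert x (row 0 (rsk w).1)).1 := by
  rw [rsk_append, rskStep, row_zero_tabInsert]

theorem row_zero_rsk_sorted {w : List ℕ} (hw : w.Nodup) :
    (row 0 (rsk w).1).Pairwise (· < ·) ∧ ∀ z ∈ row 0 (rsk w).1, z ∈ w := by
  induction w using List.reverseRecOn with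
  | nil => simp [rsk, row]
  | append_singleton w x ih =>
    obtain ⟨h1, h2, h3⟩ := List.nodup_append.1 hw
    obtain ⟨i1, i2⟩ := ih h1
    rw [row_zero_rsk_append]
    refine ⟨rowInsert_sorted i1 fun h => h3 x (i2 x h) x (by simp) rfl, fun z hz => ?_⟩
    rcases mem_rowInsert hz with rfl | h
    · simp
    · simp [i2 z h]

theorem tabInsert_snd_of_some {x y : ℕ} {T : List (List ℕ)}
    (h : (rowInsert x (row 0 T)).2 = some y) : ∃ k, (tabInsert x T).2 = k + 1 := by
  cases T with
  | nil => simp [row, rowInsert] at h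
  | cons r T =>
    simp only [row, List.getD_cons_zero] at h
    exact ⟨(tabInsert y T).2, by simp [tabInsert, h]⟩

theorem row_zero_addCell_succ (i k : ℕ) {T : List (List ℕ)} (hT : row 0 T ≠ []) :
    row 0 (addCell i (k + 1) T) = row 0 T := by
  cases T with
  | nil => simp [row] at hT
  | cons r T => simp [addCell, row]

/-- The first row of the recording tableau records the lengths of the first row of the insertion
tableaux of the prefixes. -/
theorem row_zero_recording (w : List ℕ) :
    (row 0 (rsk w).1).length = (row 0 (rsk w).2).length ∧
      (∀ z ∈ row 0 (rsk w).2, z < w.length) ∧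
      ∀ i ≤ w.length, cnt i (row 0 (rsk w).2) = (row 0 (rsk (w.take i)).1).length := by
  induction w using List.reverseRecOn with
  | nil => simp [rsk, row, cnt]
  | append_singleton w x ih =>
    obtain ⟨h1, h2, h3⟩ := ih
    suffices hs : (row 0 (rsk (w ++ [x])).1).length = (row 0 (rsk (w ++ [x])).2).length ∧
        (row 0 (rsk (w ++ [x])).2 = row 0 (rsk w).2 ∨
          row 0 (rsk (w ++ [x])).2 = row 0 (rsk w).2 ++ [w.length]) by
      obtain ⟨s1, s2⟩ := hs
      have s3 : ∀ z ∈ row 0 (rsk (w ++ [x])).2, z < (w ++ [x]).length := by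
        intro z hz
        rw [List.length_append, List.length_singleton]
        rcases s2 with s2 | s2
        · rw [s2] at hz; have := h2 z hz; omega
        · rw [s2, List.mem_append, List.mem_singleton] at hz
          rcases hz with hz | hz
          · have := h2 z hz; omega
          · omega
      refine ⟨s1, s3, fun i hi => ?_⟩
      rcases Nat.eq_or_lt_of_le hi with rfl | hi
      · rw [List.take_length, cnt_of_forall s3, s1]
      · rw [List.length_append, List.length_singleton] at hi
        rw [List.take_append_of_le_length (by omega), ← h3 i (by omega)]
        rcases s2 with s2 | s2
        · rw [s2]
        · rw [s2, cnt_append, cnt_cons, if_neg (by omega)]; simp [cnt]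
    rw [row_zero_rsk_append]
    cases hb : (rowInsert x (row 0 (rsk w).1)).2 with
    | none =>
      have e : row 0 (rsk (w ++ [x])).2 = row 0 (rsk w).2 ++ [w.length] := by
        rw [rsk_append, rskStep, (row_one_tabInsert_none hb).2, (row_addCell_zero _ _).1]
      exact ⟨by rw [e, (rowInsert_none hb).1]; simp [h1], Or.inr e⟩
    | some y =>
      obtain ⟨s, t, e1, e2, -, -⟩ := rowInsert_some hb
      obtain ⟨k, hk⟩ := tabInsert_snd_of_some hb
      have e : row 0 (rsk (w ++ [x])).2 = row 0 (rsk w).2 := by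
        rw [rsk_append, rskStep, hk, row_zero_addCell_succ]
        intro h
        rw [h, e1] at h1
        simp at h1
      exact ⟨by rw [e, ← h1, e1, ← e1, e2, e1]; simp, Or.inl e⟩

theorem Grid.lpp_succ_of_mem {n : ℕ} {X : ℕ → ℕ → Prop} (g : Grid n X) {i z j : ℕ} (h : X i z)
    (hz : z < j) : lpp X (i + 1) j = max (lpp X i j) (lpp X i z + 1) := by
  have h1 := lpp_le_succ_left (X := X) i j
  have h2 := lpp_point h (Nat.lt_add_one i) hz
  refine le_antisymm ?_ (max_le h1 h2)
  obtain ⟨p, y, a, b, c, d⟩ := exists_last (X := X) (i := i + 1) (j := j) (by omega)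
  rcases Nat.lt_succ_iff_lt_or_eq.1 a with a | rfl
  · exact le_max_of_le_left (d ▸ lpp_point c a b)
  · rw [g.right_unique h c]; exact le_max_of_le_right d.le

/-- The graph of `σ` as a relation on the natural numbers. -/
def graph {n : ℕ} (σ : Equiv.Perm (Fin n)) (i j : ℕ) : Prop := ∃ a : Fin n, ↑a = i ∧ ↑(σ a) = j

theorem containsPattern_of_lt {n : ℕ} {σ : Equiv.Perm (Fin n)} {τ : Equiv.Perm (Fin 3)}
    {a b c : Fin n} (hab : a < b) (hbc : b < c)
    (h : ∀ i j, σ (![a, b, c] i) < σ (![a, b, c] j) ↔ τ i < τ j) : ContainsPattern σ τ := by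
  refine ⟨![a, b, c], ?_, h⟩
  intro i j hij
  fin_cases i <;> fin_cases j <;> simp at hij ⊢
  · exact hab
  · exact hab.trans hbc
  · exact hbc

theorem not_321 {n : ℕ} {σ : Equiv.Perm (Fin n)} (hσ : σ ∈ Avoiders n p321) {a b c : Fin n}
    (hab : a < b) (hbc : b < c) (h1 : σ b < σ a) (h2 : σ c < σ b) : False := by
  refine hσ (containsPattern_of_lt hab hbc fun i j => ?_)
  fin_cases i <;> fin_cases j <;> simp [p321, Equiv.swap_apply_def, h1, h2, h2.trans h1, h1.le,
    h2.le, (h2.trans h1).le]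

theorem grid_graph {n : ℕ} {σ : Equiv.Perm (Fin n)} (hσ : σ ∈ Avoiders n p321) :
    Grid n (graph σ) where
  lt := by rintro _ _ ⟨a, rfl, rfl⟩; exact ⟨a.2, (σ a).2⟩
  total i hi := ⟨σ ⟨i, hi⟩, ⟨i, hi⟩, rfl, rfl⟩
  onto j hj := ⟨σ.symm ⟨j, hj⟩, σ.symm ⟨j, hj⟩, rfl, by simp⟩
  right_unique := by
    rintro i j j' ⟨a, rfl, rfl⟩ ⟨b, hb, rfl⟩
    rw [Fin.ext hb]
  left_unique := by
    rintro i i' j ⟨a, rfl, rfl⟩ ⟨b, rfl, hb⟩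
    rw [σ.injective (Fin.ext hb)]
  avoid := by
    rintro _ _ _ _ _ _ ⟨a, rfl, rfl⟩ ⟨b, rfl, rfl⟩ ⟨c, rfl, rfl⟩ h1 h2 h3 h4
    exact not_321 hσ h1 h2 h3 h4

theorem nodup_word {n : ℕ} (σ : Equiv.Perm (Fin n)) : (word σ).Nodup :=
  (perm_word σ).nodup_iff.2 List.nodup_range

/-- Schensted's theorem for the first `i` letters, with the values cut off at `v`: the two sides
satisfy the same recursion in `i`. -/
theorem cnt_row_zero_take {n : ℕ} {σ : Equiv.Perm (Fin n)} (hσ : σ ∈ Avoiders n p321) {i : ℕ}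
    (hi : i ≤ n) (v : ℕ) :
    cnt v (row 0 (rsk ((word σ).take i)).1) = lpp (graph σ) i v := by
  have g := grid_graph hσ
  induction i generalizing v with
  | zero => simp [rsk, row, cnt]
  | succ i ih =>
    have ih := ih (by omega)
    have hx : (word σ)[i]? = some (σ ⟨i, hi⟩ : ℕ) := by
      simp [word, show i < n from hi]
    have hX : graph σ i (σ ⟨i, hi⟩) := ⟨⟨i, hi⟩, rfl, rfl⟩
    have e : (word σ).take (i + 1) = (word σ).take i ++ [(σ ⟨i, hi⟩ : ℕ)] := by
      rw [List.take_add_one, hx]; rfl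
    have hnd : ((word σ).take (i + 1)).Nodup := (nodup_word σ).sublist (List.take_sublist _ _)
    rw [e] at hnd ⊢
    obtain ⟨h1, -, h3⟩ := List.nodup_append.1 hnd
    obtain ⟨s1, s2⟩ := row_zero_rsk_sorted h1
    rw [row_zero_rsk_append, cnt_rowInsert s1 fun h => h3 _ (s2 _ h) _ (by simp) rfl, ih, ih]
    split_ifs with hv
    · rw [g.lpp_succ_of_mem hX hv]
    · rw [lpp_succ_left_eq_of_empty]
      intro y hy h
      have := g.right_unique hX h
      omega

theorem cnt_row_zero_P {n : ℕ} {σ : Equiv.Perm (Fin n)} (hσ : σ ∈ Avoiders n p321) (v : ℕ) :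
    cnt v (row 0 (rsk (word σ)).1) = lpp (graph σ) n v := by
  rw [← cnt_row_zero_take hσ le_rfl, List.take_of_length_le]
  simp [word]

theorem cnt_row_zero_Q {n : ℕ} {σ : Equiv.Perm (Fin n)} (hσ : σ ∈ Avoiders n p321) {i : ℕ}
    (hi : i ≤ n) : cnt i (row 0 (rsk (word σ)).2) = lpp (graph σ) i n := by
  rw [(row_zero_recording (word σ)).2.2 i (by simpa [word] using hi), ← cnt_row_zero_take hσ hi,
    cnt_of_forall]
  intro z hz
  have := (row_zero_rsk_sorted ((nodup_word σ).sublist (List.take_sublist i _))).2 z hz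
  exact List.mem_range.1 ((perm_word σ).mem_iff.1 ((List.take_sublist _ _).mem this))

/-! ### The heights of the path of a permutation -/

theorem cnt_add_cnt {n v : ℕ} {a b : List ℕ} (h : (a ++ b).Perm (List.range n)) (hv : v ≤ n) :
    cnt v a + cnt v b = v := by
  rw [← cnt_append, cnt, h.countP_eq]
  change cnt v (List.range n) = v
  rw [← countP_range_mem List.nodup_range, List.countP_eq_length.2, List.length_range]
  intro z hz
  have := List.mem_range.1 hz
  simp; omega

theorem height_psi_left {n : ℕ} (σ : Avoiders n p321) {j : ℕ} (hj : j ≤ n) :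
    height (psi σ) j = ght (graph σ.1) n j := by
  have hP := (inv_word σ.2).permP.trans (perm_word σ.1)
  have e : (psi σ).toList.take j = (List.range j).map fun i =>
      if i ∈ row 0 (rsk (word σ.1)).1 then DyckStep.U else DyckStep.D := by
    simp only [psi, path]
    rw [List.take_append_of_le_length (by simpa using hj), ← List.map_take, List.take_range,
      min_eq_left hj]
  obtain ⟨h1, h2⟩ := count_range_map hP hj (show DyckStep.U ≠ DyckStep.D by decide)
  have h3 := cnt_add_cnt hP hj
  rw [height, e, h1, h2, ght, ← cnt_row_zero_P σ.2, (grid_graph σ.2).npt_left_full hj]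
  omega

/-- The last `i` steps are read off the entries `< i` of `Q`. As the whole path returns to the axis,
they give the height at their start. -/
theorem height_psi_right {n : ℕ} (σ : Avoiders n p321) {i : ℕ} (hi : i ≤ n) :
    height (psi σ) (2 * n - i) = ght (graph σ.1) i n := by
  have hQ := (inv_word σ.2).permQ
  rw [show (word σ.1).length = n by simp [word]] at hQ
  have e : (psi σ).toList.drop (2 * n - i) = ((List.range i).map fun j =>
      if j ∈ row 0 (rsk (word σ.1)).2 then DyckStep.D else DyckStep.U).reverse := by
    simp only [psi, path]
    rw [List.drop_append, List.drop_of_length_le (by simp; omega), List.nil_append,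
      ← List.map_drop, ← List.map_reverse, List.drop_reverse, List.take_range]
    simp only [List.length_map, List.length_range]
    congr 3
    omega
  obtain ⟨h1, h2⟩ := count_range_map hQ hi (show DyckStep.D ≠ DyckStep.U by decide)
  have h3 := cnt_add_cnt hQ hi
  have h4 := (psi σ).count_U_eq_count_D
  rw [← List.take_append_drop (2 * n - i) (psi σ).toList, List.count_append, List.count_append, e,
    List.count_reverse, List.count_reverse, h1, h2] at h4
  rw [height, ght, ← cnt_row_zero_Q σ.2 hi, (grid_graph σ.2).npt_right_full hi]
  omega

/-! ### The crossings of a 321-avoiding permutation -/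

section Crossings

variable {n : ℕ} {σ : Equiv.Perm (Fin n)}

open Finset in
theorem crs_eq_sum_card (σ : Equiv.Perm (Fin n)) :
    crs σ = ∑ k, (#{i | i < k ∧ k < σ i ∧ σ i < σ k} + #{j | σ k < σ j ∧ σ j ≤ k ∧ k < j}) := by
  have h : ∀ p : Fin n × Fin n, (if (p.1 < p.2 ∧ p.2 < σ p.1 ∧ σ p.1 < σ p.2) ∨
      (σ p.1 < σ p.2 ∧ σ p.2 ≤ p.1 ∧ p.1 < p.2) then 1 else 0) =
      (if p.1 < p.2 ∧ p.2 < σ p.1 ∧ σ p.1 < σ p.2 then 1 else 0) +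
      if σ p.1 < σ p.2 ∧ σ p.2 ≤ p.1 ∧ p.1 < p.2 then 1 else 0 := by
    intro p
    by_cases h1 : p.1 < p.2 ∧ p.2 < σ p.1 ∧ σ p.1 < σ p.2
    · have h2 : ¬ (σ p.1 < σ p.2 ∧ σ p.2 ≤ p.1 ∧ p.1 < p.2) := by omega
      rw [if_pos h1, if_neg h2, if_pos (Or.inl h1)]
    · simp only [h1, if_false, false_or, zero_add]
  rw [crs, card_filter, sum_congr rfl fun p _ => h p, sum_add_distrib, Fintype.sum_prod_type,
    Fintype.sum_prod_type, sum_comm, sum_add_distrib]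
  simp only [card_filter]

-- The sets `{j | σ j ≤ k}` and `{j | j ≤ k}` have the same size, and removing their common part
-- leaves the two sides.
open Finset in
theorem card_le_lt (σ : Equiv.Perm (Fin n)) (k : Fin n) :
    #{j | k < j ∧ σ j ≤ k} = #{i | i ≤ k ∧ k < σ i} := by
  have h : #{j : Fin n | σ j ≤ k} = #{j | j ≤ k} := card_equiv σ (by simp)
  rw [← card_filter_add_card_filter_not (fun j => k < j),
    ← card_filter_add_card_filter_not (s := ({j | j ≤ k} : Finset (Fin n))) (fun j => k < σ j),
    filter_filter, filter_filter, filter_filter, filter_filter] at h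
  have e : ({a | σ a ≤ k ∧ ¬ k < a} : Finset (Fin n)) =
      ({a | a ≤ k ∧ ¬ k < σ a} : Finset (Fin n)) := by
    ext a; simp only [mem_filter, mem_univ, true_and]; omega
  rw [e] at h
  simp only [and_comm (a := k < _) (b := σ _ ≤ k)]
  omega

open Finset in
theorem exists_lt_of_le (σ : Equiv.Perm (Fin n)) (k : Fin n) :
    (∃ j, k < j ∧ σ j ≤ k) ↔ ∃ i, i ≤ k ∧ k < σ i := by
  have := card_le_lt σ k
  constructor
  · rintro ⟨j, hj⟩
    have h : 0 < #{j | k < j ∧ σ j ≤ k} := card_pos.2 ⟨j, by simpa using hj⟩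
    obtain ⟨i, hi⟩ := card_pos.1 (this ▸ h)
    exact ⟨i, by simpa using hi⟩
  · rintro ⟨j, hj⟩
    have h : 0 < #{i | i ≤ k ∧ k < σ i} := card_pos.2 ⟨j, by simpa using hj⟩
    obtain ⟨i, hi⟩ := card_pos.1 (this ▸ h)
    exact ⟨i, by simpa using hi⟩

-- An upper crossing is charged to its second position and a lower one to its first. Whenever `i < k
-- < σ i` for some `i`, there is also a `j` with `σ j ≤ k < j`. By avoidance of 321, an excedance
-- `k` then crosses every such `i`, an anti-excedance `k` crosses every such `j`, and a fixed point
-- `k` admits no such `i`.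
open Finset in
theorem crs_of_avoids_321 (hσ : σ ∈ Avoiders n p321) :
    crs σ = ∑ k : Fin n, #{i | i < k ∧ k < σ i} := by
  rw [crs_eq_sum_card]
  refine sum_congr rfl fun k _ => ?_
  rcases lt_trichotomy (σ k) k with h | h | h
  · have e1 : ({i | i < k ∧ k < σ i ∧ σ i < σ k} : Finset (Fin n)) = ∅ := by
      ext a; simp only [mem_filter, mem_univ, true_and, notMem_empty, iff_false]; omega
    have e2 : ({j | σ k < σ j ∧ σ j ≤ k ∧ k < j} : Finset (Fin n)) =
        ({j | k < j ∧ σ j ≤ k} : Finset (Fin n)) := by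
      ext j
      simp only [mem_filter, mem_univ, true_and]
      refine ⟨fun h => ⟨h.2.2, h.2.1⟩, fun h' => ⟨?_, h'.2, h'.1⟩⟩
      by_contra hc
      have hne : σ j ≠ σ k := fun e => h'.1.ne' (σ.injective e)
      obtain ⟨i, hi, hi'⟩ := (exists_lt_of_le σ k).1 ⟨j, h'⟩
      have hik : i ≠ k := by rintro rfl; omega
      exact not_321 hσ (lt_of_le_of_ne hi hik) h'.1 (h.trans hi')
        (lt_of_le_of_ne (not_lt.1 hc) hne)
    have e3 : ({i | i ≤ k ∧ k < σ i} : Finset (Fin n)) =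
        ({i | i < k ∧ k < σ i} : Finset (Fin n)) := by
      ext i
      simp only [mem_filter, mem_univ, true_and]
      refine ⟨fun h' => ⟨lt_of_le_of_ne h'.1 ?_, h'.2⟩, fun h => ⟨h.1.le, h.2⟩⟩
      rintro rfl; omega
    rw [e1, e2, card_le_lt, e3, card_empty, zero_add]
  · have e1 : ({i | i < k ∧ k < σ i ∧ σ i < σ k} : Finset (Fin n)) = ∅ := by
      ext a; simp only [mem_filter, mem_univ, true_and, notMem_empty, iff_false]; omega
    have e2 : ({j | σ k < σ j ∧ σ j ≤ k ∧ k < j} : Finset (Fin n)) = ∅ := by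
      ext a; simp only [mem_filter, mem_univ, true_and, notMem_empty, iff_false]; omega
    have e3 : ({i | i < k ∧ k < σ i} : Finset (Fin n)) = ∅ := by
      ext i
      simp only [mem_filter, mem_univ, true_and, notMem_empty, iff_false]
      rintro ⟨hi, hi'⟩
      obtain ⟨j, hj, hj'⟩ := (exists_lt_of_le σ k).2 ⟨i, hi.le, hi'⟩
      have hne : σ j ≠ σ k := fun e => hj.ne' (σ.injective e)
      exact not_321 hσ hi hj (by omega) (lt_of_le_of_ne (by omega) hne)
    rw [e1, e2, e3]; rfl
  · have e1 : ({i | i < k ∧ k < σ i ∧ σ i < σ k} : Finset (Fin n)) =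
        ({i | i < k ∧ k < σ i} : Finset (Fin n)) := by
      ext i
      simp only [mem_filter, mem_univ, true_and]
      refine ⟨fun h => ⟨h.1, h.2.1⟩, fun h' => ⟨h'.1, h'.2, ?_⟩⟩
      by_contra hc
      have hne : σ i ≠ σ k := fun e => h'.1.ne (σ.injective e)
      obtain ⟨j, hj, hj'⟩ := (exists_lt_of_le σ k).2 ⟨i, h'.1.le, h'.2⟩
      exact not_321 hσ h'.1 hj (lt_of_le_of_ne (not_lt.1 hc) hne.symm) (by omega)
    have e2 : ({j | σ k < σ j ∧ σ j ≤ k ∧ k < j} : Finset (Fin n)) = ∅ := by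
      ext a; simp only [mem_filter, mem_univ, true_and, notMem_empty, iff_false]; omega
    rw [e1, e2, card_empty, add_zero]

open Finset in
theorem card_add_npt (hσ : σ ∈ Avoiders n p321) {i : ℕ} (hi : i ≤ n) (m : ℕ) :
    #{a : Fin n | ↑a < i ∧ m ≤ ↑(σ a)} + npt (graph σ) i m = i := by
  have g := grid_graph hσ
  induction i with
  | zero => simp
  | succ i ih =>
    have ih := ih (by omega)
    set b : Fin n := ⟨i, hi⟩
    have hX : graph σ i (σ b) := ⟨b, rfl, rfl⟩
    by_cases h : m ≤ (σ b : ℕ)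
    · have e : ({a : Fin n | ↑a < i + 1 ∧ m ≤ ↑(σ a)} : Finset (Fin n)) =
          insert b ({a : Fin n | ↑a < i ∧ m ≤ ↑(σ a)} : Finset (Fin n)) := by
        ext a
        simp only [mem_filter, mem_univ, true_and, mem_insert, Fin.ext_iff]
        constructor
        · intro h'
          by_cases hab : (a : ℕ) = i
          · exact Or.inl hab
          · exact Or.inr (by omega)
        · rintro (h' | h')
          · rw [Fin.ext (a := a) (b := b) h']; exact ⟨Nat.lt_add_one i, h⟩
          · omega
      rw [e, card_insert_of_notMem (by simp [b]), npt_succ_left_of_empty fun y hy h' => by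
        have := g.right_unique hX h'; omega]
      omega
    · have e : ({a : Fin n | ↑a < i + 1 ∧ m ≤ ↑(σ a)} : Finset (Fin n)) =
          ({a : Fin n | ↑a < i ∧ m ≤ ↑(σ a)} : Finset (Fin n)) := by
        ext a
        simp only [mem_filter, mem_univ, true_and]
        refine ⟨fun h' => ⟨?_, h'.2⟩, fun h => ⟨by omega, h.2⟩⟩
        rcases Nat.lt_succ_iff_lt_or_eq.1 h'.1 with h1 | h1
        · exact h1
        · rw [Fin.ext (a := a) (b := b) h1] at h'; exact absurd h'.2 h
      rw [e, g.npt_succ_left_of_mem hX (not_le.1 h)]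
      omega

/-- The least height of the path of `σ` between the abscissas `k + 1` and `2 n - k`. -/
theorem exists_min_height (σ : Avoiders n p321) (k : Fin n) :
    ∃ w, (k : ℕ) + 1 ≤ w ∧ w ≤ 2 * n - k ∧
      (∀ v, (k : ℕ) + 1 ≤ v → v ≤ 2 * n - k → height (psi σ) w ≤ height (psi σ) v) ∧
      height (psi σ) (k + 1) + height (psi σ) (2 * n - k) - 2 * height (psi σ) w =
        2 * ((Finset.univ.filter fun i => i < k ∧ k < σ.1 i).card : ℤ) + 1 := by
  have hk := k.2
  obtain ⟨M, h1, h2, h3, h4⟩ := (grid_graph σ.2).exists_min_ght hk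
  have hM : ∀ v, (k : ℕ) + 1 ≤ v → v ≤ 2 * n - k → M ≤ height (psi σ) v := by
    intro v hv hv'
    rcases le_total v n with h | h
    · rw [height_psi_left σ h]; exact h2 v hv h
    · have e : v = 2 * n - (2 * n - v) := by omega
      rw [e, height_psi_right σ (by omega)]
      exact h1 _ (by omega) (by omega)
  obtain ⟨w, w1, w2, w3⟩ : ∃ w, (k : ℕ) + 1 ≤ w ∧ w ≤ 2 * n - k ∧ height (psi σ) w ≤ M := by
    rcases h3 with ⟨i, i1, i2, i3⟩ | ⟨j, j1, j2, j3⟩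
    · exact ⟨2 * n - i, by omega, by omega, by rwa [height_psi_right σ i2]⟩
    · exact ⟨j, by omega, by omega, by rwa [height_psi_left σ j2]⟩
  have hw : height (psi σ) w = M := le_antisymm w3 (hM w w1 w2)
  refine ⟨w, w1, w2, fun v hv hv' => hw ▸ hM v hv hv', ?_⟩
  rw [hw, height_psi_left σ hk, height_psi_right σ hk.le, h4]
  have h5 := card_add_npt σ.2 hk.le (k + 1)
  have e : (Finset.univ.filter fun i : Fin n => (i : ℕ) < k ∧ (k : ℕ) + 1 ≤ σ.1 i) =
      Finset.univ.filter fun i => i < k ∧ k < σ.1 i := rfl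
  rw [e] at h5
  omega

end Crossings

/-! ### The arcs of a Dyck path -/

theorem card_filter_fin_le_lt {n a b : ℕ} (hb : b ≤ n) :
    (Finset.univ.filter fun k : Fin n => a ≤ (k : ℕ) ∧ (k : ℕ) < b).card = b - a := by
  have h := Finset.card_map (Fin.valEmbedding (n := n))
    (s := Finset.univ.filter fun k : Fin n => a ≤ (k : ℕ) ∧ (k : ℕ) < b)
  rw [← h, ← Nat.card_Ico]
  congr 1
  ext x
  simp only [Finset.mem_map, Finset.mem_filter, Finset.mem_univ, true_and, Fin.valEmbedding_apply,
    Finset.mem_Ico]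
  exact ⟨by rintro ⟨k, hk, rfl⟩; exact hk, fun h => ⟨⟨x, by omega⟩, h, rfl⟩⟩

theorem count_U_add_count_D (l : List DyckStep) :
    l.count DyckStep.U + l.count DyckStep.D = l.length := by
  induction l with
  | nil => rfl
  | cons s l ih => cases s <;> simp <;> omega

theorem lt_iff_count_take_lt {s : DyckStep} {l : List DyckStep} {a : ℕ} (ha : l[a]? = some s)
    (v : ℕ) : a < v ↔ (l.take a).count s < (l.take v).count s := by
  have h1 : (l.take (a + 1)).count s = (l.take a).count s + 1 := by
    simp [List.take_add_one, ha]
  constructor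
  · intro h
    have := (List.take_sublist_take_left (l := l) (show a + 1 ≤ v from h)).count_le s
    omega
  · intro h
    by_contra hc
    have := (List.take_sublist_take_left (l := l) (not_lt.1 hc)).count_le s
    omega

/-- The number of up steps among the first `v` steps of `D`. -/
def ups (D : DyckWord) (v : ℕ) : ℕ := (D.toList.take v).count DyckStep.U

/-- The number of down steps among the first `v` steps of `D`. -/
def downs (D : DyckWord) (v : ℕ) : ℕ := (D.toList.take v).count DyckStep.D

/-- The up step numbered `p` of `D` is at `u p`, and it is linked to the down step numbered `τ p`,
which is at `d p`. -/
structure Arcs {n : ℕ} (D : DyckWord) (τ : Equiv.Perm (Fin n)) (u d : Fin n → ℕ) : Prop where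
  semilength : D.semilength = n
  up : ∀ p, D.toList[u p]? = some DyckStep.U
  ups_up : ∀ p, ups D (u p) + p + 1 = n
  down : ∀ p, D.toList[d p]? = some DyckStep.D
  downs_down : ∀ p, downs D (d p) = τ p
  tunnel : ∀ p, IsTunnel D (u p) (d p + 1)

theorem exists_arcs {n : ℕ} (D : DyckWord) (hD : D.semilength = n) :
    ∃ u d, Arcs D (phiInv D hD) u d := by
  have h := fun p => (phiInv_eq_iff D hD p _).1 rfl
  choose u d h1 h2 h3 h4 h5 using h
  refine ⟨u, d, hD, h1, fun p => ?_, h3, h4, h5⟩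
  have := count_drop_U (h1 p)
  have := h2 p
  rw [ups]; omega

namespace Arcs

variable {n : ℕ} {D : DyckWord} {τ : Equiv.Perm (Fin n)} {u d : Fin n → ℕ}

theorem length (h : Arcs D τ u d) : D.toList.length = 2 * n := by
  have := D.two_mul_semilength_eq_length
  have := h.semilength
  omega

theorem up_lt (h : Arcs D τ u d) (p : Fin n) : u p < 2 * n :=
  h.length ▸ (List.getElem?_eq_some_iff.1 (h.up p)).1

theorem down_lt (h : Arcs D τ u d) (p : Fin n) : d p < 2 * n :=
  h.length ▸ (List.getElem?_eq_some_iff.1 (h.down p)).1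

theorem ups_add_downs (h : Arcs D τ u d) {v : ℕ} (hv : v ≤ 2 * n) : ups D v + downs D v = v := by
  rw [ups, downs, count_U_add_count_D, List.length_take, h.length, min_eq_left hv]

theorem ups_le (h : Arcs D τ u d) (v : ℕ) : ups D v ≤ n := by
  have h1 : D.toList.count DyckStep.U = n := h.semilength
  exact h1 ▸ (List.take_sublist _ _).count_le _

theorem downs_le (h : Arcs D τ u d) (v : ℕ) : downs D v ≤ n := by
  have h1 : D.toList.count DyckStep.D = n := by
    rw [← D.semilength_eq_count_D]; exact h.semilength
  exact h1 ▸ (List.take_sublist _ _).count_le _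

theorem up_lt_iff (h : Arcs D τ u d) (p : Fin n) (v : ℕ) : u p < v ↔ n < ups D v + p + 1 := by
  have h1 := lt_iff_count_take_lt (h.up p) v
  have h2 := h.ups_up p
  simp only [ups] at *
  omega

theorem down_lt_iff (h : Arcs D τ u d) (p : Fin n) (v : ℕ) :
    d p < v ↔ (τ p : ℕ) < downs D v := by
  have h1 := lt_iff_count_take_lt (h.down p) v
  have h2 := h.downs_down p
  simp only [downs] at *
  omega

theorem up_lt_up_iff (h : Arcs D τ u d) (p q : Fin n) : u p < u q ↔ q < p := by
  have h1 := h.up_lt_iff p (u q)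
  have h2 := h.ups_up q
  omega

theorem down_lt_down_iff (h : Arcs D τ u d) (p q : Fin n) : d p < d q ↔ τ p < τ q := by
  have h1 := h.down_lt_iff p (d q)
  have h2 := h.downs_down q
  omega

theorem up_ne_down (h : Arcs D τ u d) (p q : Fin n) : u p ≠ d q := by
  intro e
  have h1 := h.up p
  have h2 := h.down q
  rw [e, h2] at h1
  simp at h1

theorem up_lt_down (h : Arcs D τ u d) (p : Fin n) : u p < d p := by
  have h1 := (h.tunnel p).1
  have h2 := h.up_ne_down p p
  omega

theorem noncrossing (h : Arcs D τ u d) {p q : Fin n} (h1 : u p < u q) (h2 : u q < d p) :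
    d q < d p := by
  obtain ⟨-, a2, a3⟩ := h.tunnel p
  obtain ⟨-, b2, b3⟩ := h.tunnel q
  by_contra hc
  have hne : d q ≠ d p := by
    intro e
    have := h.down_lt_down_iff q p
    have := h.down_lt_down_iff p q
    have hqp : q = p := τ.injective (by omega)
    subst hqp
    omega
  have := a3 (u q) h1 (by omega)
  have := b3 (d p + 1) (by omega) (by omega)
  omega

/-- This expresses the order of up steps against down steps through `τ` alone, which is why `τ`
determines the path. -/
theorem up_lt_down_iff (h : Arcs D τ u d) (p q : Fin n) :
    u p < d q ↔ q ≤ p ∨ τ p < τ q := by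
  have h1 := h.up_lt_up_iff q p
  have h2 := h.down_lt_down_iff p q
  have h3 := h.up_lt_down p
  have h4 := h.up_lt_down q
  constructor
  · intro hlt
    by_contra! hc
    have := h.noncrossing (h1.2 hc.1) hlt
    omega
  · rintro (hqp | hqp)
    · have := h.up_lt_up_iff q p
      omega
    · omega

/-- The arcs of the entries 3 and 2 of a 132 would cross: the arc of the entry 1 starts after both
start and ends before both end, so both are open at once, and the one opened first also closes
first. -/
theorem avoids_132 (h : Arcs D τ u d) : τ ∈ Avoiders n p132 := by
  rintro ⟨f, hf, hτ⟩
  have a : f 1 < f 2 := hf (by decide)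
  have b : τ (f 0) < τ (f 2) := (hτ 0 2).2 (by decide)
  have c : τ (f 2) < τ (f 1) := (hτ 2 1).2 (by decide)
  have e : f 0 < f 1 := hf (by decide)
  have h1 := (h.up_lt_up_iff (f 2) (f 1)).2 a
  have h2 := (h.up_lt_up_iff (f 1) (f 0)).2 e
  have h3 := (h.down_lt_down_iff (f 0) (f 2)).2 b
  have h4 := (h.down_lt_down_iff (f 2) (f 1)).2 c
  have h5 := h.up_lt_down (f 0)
  have := h.noncrossing h1 (by omega)
  omega

open Finset in
theorem ups_eq_card (h : Arcs D τ u d) (v : ℕ) : ups D v = #{p | u p < v} := by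
  have h1 := h.ups_le v
  have h2 := card_filter_fin_le_lt (n := n) (a := n - ups D v) (le_refl n)
  rw [show n - (n - ups D v) = ups D v by omega] at h2
  rw [← h2]
  congr 1
  ext p
  have := h.up_lt_iff p v
  simp only [mem_filter, mem_univ, true_and]
  omega

open Finset in
theorem downs_eq_card (h : Arcs D τ u d) (v : ℕ) : downs D v = #{p | d p < v} := by
  have h2 := card_filter_fin_le_lt (n := n) (a := 0) (h.downs_le v)
  rw [Nat.sub_zero] at h2
  rw [← h2]
  refine (card_equiv τ fun p => ?_).symm
  have := h.down_lt_iff p v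
  simp only [mem_filter, mem_univ, true_and]
  omega

theorem height_eq_sum (h : Arcs D τ u d) (v : ℕ) :
    height D v = ∑ p, ((if u p < v then 1 else 0) - (if d p < v then 1 else 0) : ℤ) := by
  have h1 := h.ups_eq_card v
  have h2 := h.downs_eq_card v
  rw [ups, Finset.card_filter] at h1
  rw [downs, Finset.card_filter] at h2
  rw [height, h1, h2, Finset.sum_sub_distrib]
  push_cast
  rfl

/-- The arcs that have exactly one of their steps between two vertices. -/
theorem card_separated (h : Arcs D τ u d) {x w y : ℕ} (hxw : x ≤ w) (hwy : w ≤ y)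
    (hw : ∀ v, x ≤ v → v ≤ y → height D w ≤ height D v) :
    ((Finset.univ.filter fun p => ¬ ((x ≤ u p ∧ u p < y) ↔ (x ≤ d p ∧ d p < y))).card : ℤ) =
      height D x + height D y - 2 * height D w := by
  rw [h.height_eq_sum x, h.height_eq_sum y, h.height_eq_sum w, Finset.card_filter,
    Finset.mul_sum, ← Finset.sum_add_distrib, ← Finset.sum_sub_distrib]
  push_cast
  refine Finset.sum_congr rfl fun p _ => ?_
  obtain ⟨a1, a2, a3⟩ := h.tunnel p
  have hud := h.up_lt_down p
  -- By minimality at `w`, no arc open there has a step in the window: its end points would lie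
  -- below the height of `w`. So an arc open at `w` is open at both `x` and `y`, and the identity
  -- holds arc by arc.
  have c1 : x ≤ u p → u p < w → d p < w := by
    intro b1 b2
    by_contra hc
    have := a3 w b2 (by omega)
    have := hw (u p) b1 (by omega)
    omega
  have c2 : w ≤ d p → d p < y → w ≤ u p := by
    intro b1 b2
    by_contra hc
    have := a3 w (by omega) (by omega)
    have := hw (d p + 1) (by omega) (by omega)
    omega
  split_ifs <;> omega

-- Here `i < j` and `τ i < τ j` say that the arc of `i` is nested in that of `j`. Nested arcs are
-- those whose down step lies between `u j` and `d j`, so the values `τ i` fill an interval. In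
-- `card_lower_crossings` it is the up steps, hence the positions `i`, that fill one.
open Finset in
theorem card_upper_crossings (h : Arcs D τ u d) {j : Fin n} (hjt : j < τ j) :
    #{i | (i < j ∧ j < τ i ∧ τ i < τ j) ∨ (τ i < τ j ∧ τ j ≤ i ∧ i < j)} =
      (τ j : ℕ) - max ((j : ℕ) + 1) (downs D (u j)) := by
  rw [← card_filter_fin_le_lt (τ j).2.le]
  refine card_equiv τ fun i => ?_
  simp only [mem_filter, mem_univ, true_and, max_le_iff]
  have b3 := h.down_lt_down_iff i j
  have b4 := h.down_lt_iff i (u j)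
  constructor
  · rintro (⟨a1, a2, a3⟩ | ⟨a1, a2, a3⟩)
    · have := (h.up_lt_up_iff j i).2 a1
      have := h.up_lt_down i
      exact ⟨⟨a2, by omega⟩, a3⟩
    · exact absurd (a2.trans_lt a3) (not_lt.2 hjt.le)
  · rintro ⟨⟨a1, a2⟩, a3⟩
    refine Or.inl ⟨(h.up_lt_up_iff j i).1 ?_, a1, a3⟩
    have b6 := h.up_ne_down j i
    have hd : d i < d j := b3.2 a3
    rcases lt_trichotomy (u i) (u j) with hlt | heq | hgt
    · have := h.noncrossing hlt (by omega)
      omega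
    · have h1 := h.up_lt_up_iff i j
      have h2 := h.up_lt_up_iff j i
      have hij : i = j := by omega
      rw [hij] at hd
      exact absurd hd (lt_irrefl _)
    · exact hgt

open Finset in
theorem card_lower_crossings (h : Arcs D τ u d) {j : Fin n} (hjt : τ j ≤ j) :
    #{i | (i < j ∧ j < τ i ∧ τ i < τ j) ∨ (τ i < τ j ∧ τ j ≤ i ∧ i < j)} =
      (j : ℕ) - max (τ j : ℕ) (n - ups D (d j)) := by
  rw [← card_filter_fin_le_lt j.2.le]
  congr 1
  ext i
  simp only [mem_filter, mem_univ, true_and, max_le_iff]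
  have b4 := h.up_lt_iff i (d j)
  have b8 := h.ups_le (d j)
  constructor
  · rintro (⟨a1, a2, a3⟩ | ⟨a1, a2, a3⟩)
    · exact absurd (a2.trans a3) (not_lt.2 hjt)
    · have := (h.down_lt_down_iff i j).2 a1
      have := h.up_lt_down i
      exact ⟨⟨a2, by omega⟩, a3⟩
  · rintro ⟨⟨a1, a2⟩, a3⟩
    refine Or.inr ⟨(h.down_lt_down_iff i j).1 ?_, a1, a3⟩
    exact h.noncrossing ((h.up_lt_up_iff j i).2 a3) (b4.2 (by omega))

-- The windows `[k + 1, 2n - k)` are symmetric about the middle of the path. A step at `x` lies in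
-- exactly those with `k < min x (2n - x)`, so the windows that separate two steps are counted by
-- the distance of their folded positions.
open Finset in
theorem _root_.ElizaldePak.card_fold (n : ℕ) {x y : ℕ} (hxy : x < y) :
    #{k : Fin n | ¬ (((k : ℕ) + 1 ≤ x ∧ x < 2 * n - k) ↔ ((k : ℕ) + 1 ≤ y ∧ y < 2 * n - k))} =
      max (min x (2 * n - x)) (min y (2 * n - y)) -
        min (min x (2 * n - x)) (min y (2 * n - y)) := by
  rw [← card_filter_fin_le_lt (n := n) (by omega)]
  congr 1
  ext k
  have hx : ((k : ℕ) + 1 ≤ x ∧ x < 2 * n - k) ↔ (k : ℕ) < min x (2 * n - x) := by omega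
  have hy : ((k : ℕ) + 1 ≤ y ∧ y < 2 * n - k) ↔ (k : ℕ) < min y (2 * n - y) := by omega
  simp only [mem_filter, mem_univ, true_and, hx, hy]
  generalize min x (2 * n - x) = a
  generalize min y (2 * n - y) = b
  omega

open Finset in
/-- The crossings in which an arc is the outer one. -/
theorem card_crossings (h : Arcs D τ u d) (j : Fin n) :
    #{k : Fin n | ¬ (((k : ℕ) + 1 ≤ u j ∧ u j < 2 * n - k) ↔
        ((k : ℕ) + 1 ≤ d j ∧ d j < 2 * n - k))} =
      2 * #{i | (i < j ∧ j < τ i ∧ τ i < τ j) ∨ (τ i < τ j ∧ τ j ≤ i ∧ i < j)} + 1 := by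
  have e1 := h.ups_up j
  have e2 := h.downs_down j
  have e3 := h.ups_add_downs (h.up_lt j).le
  have e4 := h.ups_add_downs (h.down_lt j).le
  have e5 := (h.tunnel j).2.1
  rw [height_succ_D (h.down j)] at e5
  change (ups D (u j) : ℤ) - downs D (u j) = ups D (d j) - downs D (d j) - 1 at e5
  have hud := h.up_lt_down j
  have hd := h.down_lt j
  rw [card_fold n hud]
  rcases lt_or_ge j (τ j) with hjt | hjt
  · rw [h.card_upper_crossings hjt]
    have hjt : (j : ℕ) < τ j := hjt
    -- For `j < τ j`, the side of the middle on which the arc starts decides which bound in the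
    -- maximum is effective. In the other case the side on which it ends does so.
    rcases le_total n (u j) with hu | hu
    · rw [max_eq_right (show (j : ℕ) + 1 ≤ downs D (u j) by omega)]; omega
    · rw [max_eq_left (show downs D (u j) ≤ (j : ℕ) + 1 by omega)]; omega
  · rw [h.card_lower_crossings hjt]
    have hjt : (τ j : ℕ) ≤ j := hjt
    rcases le_total n (d j) with hu | hu
    · rw [max_eq_left (show n - ups D (d j) ≤ (τ j : ℕ) by omega)]; omega
    · rw [max_eq_right (show (τ j : ℕ) ≤ n - ups D (d j) by omega)]; omega

theorem crs_eq_sum (τ : Equiv.Perm (Fin n)) : crs τ = ∑ j, (Finset.univ.filter fun i =>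
    (i < j ∧ j < τ i ∧ τ i < τ j) ∨ (τ i < τ j ∧ τ j ≤ i ∧ i < j)).card := by
  rw [crs, Finset.card_filter, Fintype.sum_prod_type, Finset.sum_comm]
  simp only [Finset.card_filter]

theorem sum_separated (h : Arcs D τ u d) :
    ∑ k : Fin n, (Finset.univ.filter fun p => ¬ (((k : ℕ) + 1 ≤ u p ∧ u p < 2 * n - k) ↔
      ((k : ℕ) + 1 ≤ d p ∧ d p < 2 * n - k))).card = 2 * crs τ + n := by
  simp only [Finset.card_filter]
  rw [Finset.sum_comm]
  simp only [← Finset.card_filter]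
  rw [Finset.sum_congr rfl fun j _ => h.card_crossings j, Finset.sum_add_distrib, crs_eq_sum,
    Finset.mul_sum]
  simp

/-- A Dyck path is determined by its permutation. -/
theorem unique {D' : DyckWord} {u' d' : Fin n → ℕ} (h : Arcs D τ u d) (h' : Arcs D' τ u' d') :
    D = D' := by
  -- The abscissa of a down step is the number of down steps before it, which is `τ p`, plus the
  -- number of up steps before it, which `up_lt_down_iff` expresses through `τ`.
  have hd : ∀ p, d p = d' p := by
    intro p
    have e1 := h.ups_add_downs (h.down_lt p).le
    have e2 := h'.ups_add_downs (h'.down_lt p).le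
    rw [h.downs_down, h.ups_eq_card] at e1
    rw [h'.downs_down, h'.ups_eq_card] at e2
    simp only [h.up_lt_down_iff] at e1
    simp only [h'.up_lt_down_iff] at e2
    omega
  have key : ∀ {D : DyckWord} {u d : Fin n → ℕ}, Arcs D τ u d → ∀ v,
      D.toList[v]? = some DyckStep.D ↔ ∃ p, d p = v := by
    intro D u d h v
    refine ⟨fun hv => ?_, fun ⟨p, hp⟩ => hp ▸ h.down p⟩
    have h1 := (lt_iff_count_take_lt hv (v + 1)).1 (Nat.lt_add_one v)
    have h2 := h.downs_le (v + 1)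
    refine ⟨τ.symm ⟨downs D v, lt_of_lt_of_le h1 h2⟩, occ_unique (h.down _) hv ?_⟩
    have := h.downs_down (τ.symm ⟨downs D v, lt_of_lt_of_le h1 h2⟩)
    rw [Equiv.apply_symm_apply] at this
    exact this
  apply DyckWord.ext
  apply List.ext_getElem?
  intro v
  have h1 := key h v
  have h2 := key h' v
  simp only [hd] at h1
  have h3 := h1.trans h2.symm
  by_cases hv : v < 2 * n
  · rw [List.getElem?_eq_getElem (h.length.symm ▸ hv),
      List.getElem?_eq_getElem (h'.length.symm ▸ hv)] at h3 ⊢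
    generalize D.toList[v]'(h.length.symm ▸ hv) = s at h3 ⊢
    generalize D'.toList[v]'(h'.length.symm ▸ hv) = t at h3 ⊢
    cases s <;> cases t <;> simp at h3 ⊢
  · rw [List.getElem?_eq_none (by rw [h.length]; omega),
      List.getElem?_eq_none (by rw [h'.length]; omega)]

end Arcs

/-! ### Crossings, avoidance and injectivity for the map `Θ` -/

theorem crs_theta {n : ℕ} (σ : Avoiders n p321) : crs (theta σ) = crs σ.1 := by
  obtain ⟨u, d, h⟩ := exists_arcs (psi σ) (semilength_psi σ)
  have h1 := h.sum_separated
  have h2 : ∀ k : Fin n, (Finset.univ.filter fun p => ¬ (((k : ℕ) + 1 ≤ u p ∧ u p < 2 * n - k) ↔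
      ((k : ℕ) + 1 ≤ d p ∧ d p < 2 * n - k))).card =
        2 * (Finset.univ.filter fun i => i < k ∧ k < σ.1 i).card + 1 := by
    intro k
    obtain ⟨w, w1, w2, w3, w4⟩ := exists_min_height σ k
    have := h.card_separated w1 w2 w3
    omega
  rw [Finset.sum_congr rfl fun k _ => h2 k, Finset.sum_add_distrib, ← Finset.mul_sum,
    ← crs_of_avoids_321 σ.2] at h1
  simp at h1
  exact h1.symm

theorem theta_avoids {n : ℕ} (σ : Avoiders n p321) : theta σ ∈ Avoiders n p132 := by
  obtain ⟨u, d, h⟩ := exists_arcs (psi σ) (semilength_psi σ)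
  exact h.avoids_132

/-- Equal images have equal paths, hence equal heights. On the outer sides `npt` is known, so the
heights give `lpp` there, and this determines the graph. -/
theorem theta_injective (n : ℕ) : Function.Injective (theta (n := n)) := by
  intro σ σ' hσ
  obtain ⟨u, d, h⟩ := exists_arcs (psi σ) (semilength_psi σ)
  obtain ⟨u', d', h'⟩ := exists_arcs (psi σ') (semilength_psi σ')
  change Arcs _ (theta σ) _ _ at h
  rw [hσ] at h
  have hD : psi σ = psi σ' := h.unique h'
  have g := grid_graph σ.2
  have g' := grid_graph σ'.2
  have e1 : ∀ i ≤ n, lpp (graph σ.1) i n = lpp (graph σ'.1) i n := by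
    intro i hi
    have a := height_psi_right σ hi
    rw [hD, height_psi_right σ' hi, ght, ght, g.npt_right_full hi, g'.npt_right_full hi] at a
    omega
  have e2 : ∀ j ≤ n, lpp (graph σ.1) n j = lpp (graph σ'.1) n j := by
    intro j hj
    have a := height_psi_left σ hj
    rw [hD, height_psi_left σ' hj, ght, ght, g.npt_left_full hj, g'.npt_left_full hj] at a
    omega
  apply Subtype.ext
  apply Equiv.ext
  intro a
  obtain ⟨b, hb, hb'⟩ := (g.determined g' e1 e2 a.2 (σ.1 a).2).1 ⟨a, rfl, rfl⟩
  rw [Fin.ext hb] at hb'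
  exact (Fin.ext hb').symm

/-! ### Running maxima and the number of avoiding permutations -/

section Counting

variable {n : ℕ}

/-- The greatest of the values `ρ 0, …, ρ i`. -/
def runMax (ρ : Equiv.Perm (Fin n)) (i : Fin n) : Fin n :=
  (Finset.Iic i).sup' ⟨i, by simp⟩ ρ

theorem le_runMax (ρ : Equiv.Perm (Fin n)) {i j : Fin n} (h : j ≤ i) : ρ j ≤ runMax ρ i :=
  Finset.le_sup' _ (by simpa using h)

theorem exists_runMax (ρ : Equiv.Perm (Fin n)) (i : Fin n) : ∃ j ≤ i, ρ j = runMax ρ i := by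
  obtain ⟨j, hj, h⟩ := Finset.exists_mem_eq_sup' (⟨i, by simp⟩ : (Finset.Iic i).Nonempty) ρ
  exact ⟨j, by simpa using hj, h.symm⟩

theorem runMax_le {ρ : Equiv.Perm (Fin n)} {i x : Fin n} (h : ∀ j ≤ i, ρ j ≤ x) :
    runMax ρ i ≤ x :=
  Finset.sup'_le _ _ fun j hj => h j (by simpa using hj)

/-- Exchanging two entries that come after a greater one keeps the running maxima. -/
theorem runMax_swap {ρ : Equiv.Perm (Fin n)} {i j k : Fin n} (hij : i < j) (hjk : j < k)
    (h1 : ρ j < ρ i) (h2 : ρ k < ρ j) : runMax (Equiv.swap j k |>.trans ρ) = runMax ρ := by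
  funext x
  apply le_antisymm
  · refine runMax_le fun y hy => ?_
    rw [Equiv.trans_apply]
    by_cases hyj : y = j
    · subst hyj
      rw [Equiv.swap_apply_left]
      exact (h2.trans h1).le.trans (le_runMax ρ (hij.le.trans hy))
    by_cases hyk : y = k
    · subst hyk
      rw [Equiv.swap_apply_right]
      exact le_runMax ρ (hjk.le.trans hy)
    rw [Equiv.swap_apply_of_ne_of_ne hyj hyk]
    exact le_runMax ρ hy
  · refine runMax_le fun y hy => ?_
    have hi : i ≤ x → ρ i ≤ runMax (Equiv.swap j k |>.trans ρ) x := fun hix => by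
      have := le_runMax (Equiv.swap j k |>.trans ρ) hix
      rwa [Equiv.trans_apply, Equiv.swap_apply_of_ne_of_ne hij.ne (hij.trans hjk).ne] at this
    by_cases hyj : y = j
    · subst hyj
      exact h1.le.trans (hi (hij.le.trans hy))
    by_cases hyk : y = k
    · subst hyk
      exact (h2.trans h1).le.trans (hi ((hij.trans hjk).le.trans hy))
    have := le_runMax (Equiv.swap j k |>.trans ρ) hy
    rwa [Equiv.trans_apply, Equiv.swap_apply_of_ne_of_ne hyj hyk] at this

theorem sum_mul_lt_swap {ρ : Equiv.Perm (Fin n)} {j k : Fin n} (hjk : j < k) (h : ρ k < ρ j) :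
    ∑ x : Fin n, (x : ℤ) * ρ x < ∑ x : Fin n, (x : ℤ) * (Equiv.swap j k |>.trans ρ) x := by
  rw [← Finset.sum_erase_add _ _ (Finset.mem_univ j),
    ← Finset.sum_erase_add (a := k) _ _ (by simp [hjk.ne']),
    ← Finset.sum_erase_add Finset.univ _ (Finset.mem_univ j),
    ← Finset.sum_erase_add (a := k) _ (fun x : Fin n => (x : ℤ) * (Equiv.swap j k |>.trans ρ) x)
      (by simp [hjk.ne'])]
  have e : ∑ x ∈ (Finset.univ.erase j).erase k, (x : ℤ) * (Equiv.swap j k |>.trans ρ) x =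
      ∑ x ∈ (Finset.univ.erase j).erase k, (x : ℤ) * ρ x := by
    refine Finset.sum_congr rfl fun x hx => ?_
    simp only [Finset.mem_erase, Finset.mem_univ, and_true] at hx
    rw [Equiv.trans_apply, Equiv.swap_apply_of_ne_of_ne hx.2 hx.1]
  rw [e]
  simp only [Equiv.trans_apply, Equiv.swap_apply_left, Equiv.swap_apply_right]
  have h1 : (0 : ℤ) < (k : ℤ) - j := by omega
  have h2 : (0 : ℤ) < (ρ j : ℤ) - ρ k := by omega
  nlinarith [mul_pos h1 h2]

/-- Among the permutations with the given running maxima, one that maximises `∑ x * σ x` avoids 321: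
exchanging the last two entries of a 321 would keep the maxima and increase the sum. -/
theorem exists_avoids_321_runMax (ρ : Equiv.Perm (Fin n)) :
    ∃ σ ∈ Avoiders n p321, runMax σ = runMax ρ := by
  classical
  obtain ⟨σ, hσ, hmax⟩ := Finset.exists_max_image
    (Finset.univ.filter fun σ : Equiv.Perm (Fin n) => runMax σ = runMax ρ)
    (fun σ => ∑ x : Fin n, (x : ℤ) * σ x) ⟨ρ, by simp⟩
  have hσ : runMax σ = runMax ρ := by simpa using hσ
  refine ⟨σ, ?_, hσ⟩
  rintro ⟨f, hf, h⟩
  have a : f 0 < f 1 := hf (by decide)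
  have b : f 1 < f 2 := hf (by decide)
  have h1 : σ (f 1) < σ (f 0) := (h 1 0).2 (by decide)
  have h2 : σ (f 2) < σ (f 1) := (h 2 1).2 (by decide)
  have := hmax (Equiv.swap (f 1) (f 2) |>.trans σ) (by simpa using (runMax_swap a b h1 h2).trans hσ)
  exact absurd (sum_mul_lt_swap b h2) (not_lt.2 this)

theorem not_132 {τ : Equiv.Perm (Fin n)} (hτ : τ ∈ Avoiders n p132) {a b c : Fin n}
    (hab : a < b) (hbc : b < c) (h1 : τ a < τ c) (h2 : τ c < τ b) : False := by
  refine hτ (containsPattern_of_lt hab hbc fun i j => ?_)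
  fin_cases i <;> fin_cases j <;> simp [p132, Equiv.swap_apply_def, h1, h2, h1.trans h2, h1.le,
    h2.le, (h1.trans h2).le]

/-- A 132-avoiding permutation is determined by its running minima. -/
theorem eq_of_runMax_rev {τ τ' : Equiv.Perm (Fin n)} (hτ : τ ∈ Avoiders n p132)
    (hτ' : τ' ∈ Avoiders n p132)
    (h : runMax (τ.trans Fin.revPerm) = runMax (τ'.trans Fin.revPerm)) : τ = τ' := by
  have key : ∀ {τ τ' : Equiv.Perm (Fin n)}, τ' ∈ Avoiders n p132 →
      runMax (τ.trans Fin.revPerm) = runMax (τ'.trans Fin.revPerm) →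
      ∀ i, (∀ j < i, τ j = τ' j) → ¬ τ i < τ' i := by
    intro τ τ' hτ' h i hi hlt
    -- At the first disagreement suppose `τ i < τ' i`. The running minimum of `τ'` at `i` is at most
    -- `τ i`, so it occurs at an earlier `j`. The value `τ i` occurs in `τ'` at a later `k`, and
    -- `j`, `i`, `k` form a 132 in `τ'`.
    obtain ⟨j, hj, hj'⟩ := exists_runMax (τ'.trans Fin.revPerm) i
    have h1 := le_runMax (τ.trans Fin.revPerm) (le_refl i)
    rw [h, ← hj'] at h1
    simp only [Equiv.trans_apply, Fin.revPerm_apply, Fin.rev_le_rev] at h1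
    have hji : j < i := lt_of_le_of_ne hj (by rintro rfl; omega)
    have hne : τ' j ≠ τ i := fun e => hji.ne (τ.injective ((hi j hji).trans e))
    set k := τ'.symm (τ i) with hk
    have hk' : τ' k = τ i := by simp [hk]
    have hik : i < k := by
      rcases lt_trichotomy k i with hki | hki | hki
      · exact absurd (τ.injective ((hi k hki).trans hk')) hki.ne
      · rw [hki] at hk'; omega
      · exact hki
    exact not_132 hτ' hji hik (by rw [hk']; exact lt_of_le_of_ne h1 hne) (by rw [hk']; exact hlt)
  apply Equiv.ext
  intro i
  induction i using WellFoundedLT.induction with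
  | _ i ih =>
    have h1 := key hτ' h i ih
    have h2 := key hτ h.symm i fun j hj => (ih j hj).symm
    exact le_antisymm (not_lt.1 h2) (not_lt.1 h1)

theorem exists_injective_avoiders (n : ℕ) :
    ∃ f : Avoiders n p132 → Avoiders n p321, Function.Injective f := by
  choose f hf hf' using exists_avoids_321_runMax (n := n)
  refine ⟨fun τ => ⟨f (τ.1.trans Fin.revPerm), hf _⟩, fun τ τ' h => Subtype.ext ?_⟩
  apply eq_of_runMax_rev τ.2 τ'.2
  rw [← hf' (τ.1.trans Fin.revPerm), ← hf' (τ'.1.trans Fin.revPerm)]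
  exact congrArg runMax (Subtype.ext_iff.1 h)

end Counting

/-! ### Surjectivity by counting -/

theorem theta_surjOn (n : ℕ) : Set.SurjOn (theta (n := n)) Set.univ (Avoiders n p132) := by
  classical
  obtain ⟨f, hf⟩ := exists_injective_avoiders n
  let t : Avoiders n p321 → Avoiders n p132 := fun σ => ⟨theta σ, theta_avoids σ⟩
  have ht : Function.Injective t := fun σ σ' h => theta_injective n (Subtype.ext_iff.1 h)
  have hb : Function.Bijective t := by
    rw [Nat.bijective_iff_injective_and_card]
    exact ⟨ht, le_antisymm (Nat.card_le_card_of_injective t ht) (Nat.card_le_card_of_injective f hf)⟩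
  intro τ hτ
  obtain ⟨σ, hσ⟩ := hb.2 ⟨τ, hτ⟩
  exact ⟨σ, trivial, Subtype.ext_iff.1 hσ⟩

end ElizaldePak

theorem mainTheorem2 (n : ℕ) :
    Set.BijOn (ElizaldePak.theta (n := n)) Set.univ
      (ElizaldePak.Avoiders n ElizaldePak.p132) ∧
    ∀ σ : ElizaldePak.Avoiders n ElizaldePak.p321,
      ElizaldePak.crs (ElizaldePak.theta σ) = ElizaldePak.crs σ.1 :=
  ⟨⟨fun σ _ => ElizaldePak.theta_avoids σ, (ElizaldePak.theta_injective n).injOn,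
    ElizaldePak.theta_surjOn n⟩, ElizaldePak.crs_theta⟩
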